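/- **Setting.** Along a sequence of experiments (index suppressed) let $N$, $M$, $T$, $K$ be the numbers of nodes, candidate models, layers and groups, with $M,T\ge 1$, $K\ge 2$. *Network.* For $t=1,\dots,T$ let $A^{(t)}\in\{0,1\}^{N\times N}$ be a symmetric random adjacency matrix with zero diagonal whose entries $A^{(t)}_{ij}$, $i<j$, are independent Bernoulli$(P^{(t)}_{ij})$, with $\operatorname{logit}P^{(t)}_{ij}=\alpha_i+\alpha_j+z_i^{(t)\top}z_j^{(t)}$ for $i\ne j$, where $\alpha_i\in\mathbb R$ is shared by the layers, $z_i^{(t)}\in\mathbb R^{d_t}$ and $\sum_i z^{(t)}_i=0$. Put $P^{(t)}=E A^{(t)}$, so that $P^{(t)}_{ii}=0$. *Split.* The set $\Psi=\{1,\dots,N\}^2$ is divided into symmetric parts $\Psi_1$, $\Psi_2$, and $\Psi_1$ is divided into groups $G_1,\dots,G_K$; the division may be random, but is independent of the network. All limits are taken along a regime where $|\Psi_1|\to\infty$ (in probability, if the split is random). *Estimators.* Let $\sigma(x)=1/(1+e^{-x})$. Given a set $E$ of observed pairs, set all entries of the $A^{(t)}$ outside $E$ to $0$, and for $m=1,\dots,M$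 run on these data the projected gradient descent algorithm for latent dimension $m$ in every layer: with $\Theta_u^{(t)}=\alpha_u1^\top+1\alpha_u^\top+Z_u^{(t)}Z_u^{(t)\top}$ and $J=I-11^\top/N$, $$Z^{(t)}_{u+1}=J\bigl[Z^{(t)}_u+2\eta_Z\{A^{(t)}-\sigma(\Theta_u^{(t)})\}Z_u^{(t)}\bigr],\qquad \alpha_{u+1}=\alpha_u+2\eta_\alpha\sum_{t}\{A^{(t)}-\sigma(\Theta^{(t)}_u)\}1 .$$ The initial values, step sizes and number of iterations may be any functions of $m$, $E$ and the observed data. Let $\widehat\Theta^{(t)}_{(m)}$ and $\widetilde\Theta_{(m)}^{(t)[-k]}$ be the matrices $\Theta^{(t)}$ at the final iteration for $E=\Psi_1$ and $E=\Psi_1\setminus G_k$, and put $\widehat P^{(t)}_{(m),ij}=\frac{|\Psi|}{|\Psi_1|}\sigma(\widehat\Theta_{(m),ij}^{(t)})$, and $\widetilde P^{(t)[k]}_{(m),ij}=\frac{K}{K-1}\sigma(\widetilde\Theta^{(t)[-k]}_{(m),ij})$ for $(i,j)\in G_k$, $0$ otherwise. *Weights.* Let $\mathcal W=\{w\in[0,1]^M:\sum_m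 w_m=1\}$, and let $\widehat w_\dagger\in\mathcal W$ be a minimizer over $\mathcal W$ of $$CV_\dagger(w)=\frac1{T|\Psi_1|}\sum_{t=1}^T\sum_{k=1}^K\sum_{i,j}\Bigl(A^{(t)}_{ij}\mathbb 1_{(i,j)\in G_k}-\sum_m w_m\widetilde P^{(t)[k]}_{(m),ij}\Bigr)^2 .$$ *Losses.* With $\widehat P^{(t)}(w)=\sum_m w_m\widehat P^{(t)}_{(m)}$ let $L_{\dagger}(w)=\sum_t\sum_{(i,j)\in\Psi_1}\{\widehat P^{(t)}_{ij}(w)-P^{(t)}_{ij}\}^2$, and let $L_{\dagger,2}(w)$ be the same sum over $(i,j)\in\Psi_2$. For nonrandom $P^{(t)*}_{(m),ij}$ let $L_\dagger^*(w)=\sum_t\sum_{(i,j)\in\Psi_1}\{\sum_m w_mP^{(t)*}_{(m),ij}-P^{(t)}_{ij}\}^2$ and $\xi_\dagger^*=\inf_{w\in\mathcal W}L_\dagger^*(w)$. Let $D_\dagger$ be a bound with $\max_{t,i,j}P^{(t)}_{ij}\le D_\dagger/N$. **Theorem.** Assume: 1. $M\le N$, and there are nonrandom limiting values $P^{(t)*}_{(m),ij}$,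 common to the full fits and to the fits with one group left out, such that $$\max_{m}\sum_t\sum_{(i,j)\in\Psi_1}\bigl(\widehat P^{(t)}_{(m),ij}-P^{(t)*}_{(m),ij}\bigr)^2=O_p(NMT),\qquad \max_m\sum_t\sum_k\sum_{(i,j)\in G_k}\bigl(\widetilde P^{(t)[k]}_{(m),ij}-P^{(t)*}_{(m),ij}\bigr)^2=O_p(NMT).$$ 2. $TN^{-C_0}=o(1)$ for some constant $C_0>0$. 3. $NMT=o(\xi_\dagger^*)$ and $N\max\{D_\dagger,\log N\}\,T=O(\xi_\dagger^*)$ (both in probability, if the split is random). Then $$\frac{L_{\dagger}(\widehat w_\dagger)}{\inf_{w\in\mathcal W}L_{\dagger}(w)}\to1\quad\text{in probability.}$$ Suppose moreover that the split is random in such a way that, given their number, all sets of unordered training pairs are equally likely; that for some constant $c>0$ one has $c\le|\Psi_1|/|\Psi|\le1-c$ with probability tending to $1$; and that also $\max_m\sum_t\sum_{(i,j)\in\Psi_2}(\widehat P^{(t)}_{(m),ij}-P^{(t)*}_{(m),ij})^2=O_p(NMT)$. Then also $L_{\dagger,2}(\widehat w_\dagger)/\inf_{w\in\mathcal W}L_{\dagger,2}(w)\to1$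 in probability. -/

import Mathlib

open Filter MeasureTheory ProbabilityTheory
open scoped Topology

namespace NetMA

noncomputable section

/-- A `T`-tuple of real `N × N` arrays (adjacency arrays, probability arrays, fitted values):
`X t i j` is the entry `(i, j)` of layer `t`. -/
abbrev Layers (N T : ℕ) := Fin T → Fin N → Fin N → ℝ

/-! ### The inner-product latent space model -/

/-- Parameters of a `T`-layer inner-product latent space model: degree parameters `α` shared by
all layers, and for each layer `t` the latent vectors `z_i ∈ ℝ^{d t}`, the rows of `Z t`. -/
structure LatentParams (N T : ℕ) (d : Fin T → ℕ) where
  α : Fin N → ℝ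
  Z : ∀ t, Fin N → Fin (d t) → ℝ

/-- `Θ_{ij}^{(t)} = α_i + α_j + ⟨z_i^{(t)}, z_j^{(t)}⟩`. -/
def LatentParams.theta {N T : ℕ} {d : Fin T → ℕ} (θ : LatentParams N T d) : Layers N T :=
  fun t i j => θ.α i + θ.α j + ∑ l, θ.Z t i l * θ.Z t j l

/-- Multiplication by `J = I - 1 1ᵀ / N`: every column is centred. -/
def center {N d : ℕ} (Z : Fin N → Fin d → ℝ) : Fin N → Fin d → ℝ :=
  fun i l => Z i l - (∑ i', Z i' l) / N

/-- The matrix of expected adjacencies: `logit P_{ij} = Θ_{ij}` off the diagonal. There are no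
self-loops, so the diagonal is zero. -/
def LatentParams.edgeProb {N T : ℕ} {d : Fin T → ℕ} (θ : LatentParams N T d) : Layers N T :=
  fun t i j => if i = j then 0 else Real.sigmoid (θ.theta t i j)

/-- `A` is a random undirected unweighted `T`-layer network without self-loops in which the edges
of each layer are independent and `A_{ij}^{(t)}` is Bernoulli with parameter `P_{ij}^{(t)}`. -/
structure IsBernoulliNetwork {Ω : Type*} [MeasurableSpace Ω] (μ : Measure Ω) {N T : ℕ}
    (A : Ω → Layers N T) (P : Layers N T) : Prop where
  measurable : Measurable A
  binary : ∀ ω t i j, A ω t i j = 0 ∨ A ω t i j = 1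
  symm : ∀ ω t i j, A ω t i j = A ω t j i
  diag : ∀ ω t i, A ω t i i = 0
  bernoulli : ∀ t i j, i < j → μ {ω | A ω t i j = 1} = ENNReal.ofReal (P t i j)
  indep : ∀ t, iIndepFun (fun (e : {e : Fin N × Fin N // e.1 < e.2}) (ω : Ω) =>
    A ω t e.1.1 e.1.2) μ

/-! ### Projected gradient descent -/

/-- Inputs of the algorithm: initial value, step sizes and number of iterations. -/
structure PGDInput (N T : ℕ) (d : Fin T → ℕ) where
  init : LatentParams N T d
  stepα : ℝ
  stepZ : ℝ
  iters : ℕ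

/-- One iteration of projected gradient descent on the negative log-likelihood of `A`. -/
def pgdStep {N T : ℕ} {d : Fin T → ℕ} (A : Layers N T) (ηα ηZ : ℝ) (θ : LatentParams N T d) :
    LatentParams N T d where
  α := fun i => θ.α i + 2 * ηα * ∑ t, ∑ j, (A t i j - Real.sigmoid (θ.theta t i j))
  Z := fun t => center fun i l =>
    θ.Z t i l + 2 * ηZ * ∑ j, (A t i j - Real.sigmoid (θ.theta t i j)) * θ.Z t j l

/-- The output of projected gradient descent run on `A`. -/
def pgd {N T : ℕ} {d : Fin T → ℕ} (A : Layers N T) (c : PGDInput N T d) : LatentParams N T d :=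
  (pgdStep A c.stepα c.stepZ)^[c.iters] c.init

/-- A choice of the inputs of the algorithm for each of the `M` candidate models, as a function of
the observed pairs and of the observed data. The candidate with index `m : Fin M` has latent
dimension `m + 1` in every layer, so the dimensions are `1, …, M`. -/
abbrev Tuning (N M T : ℕ) :=
  ∀ m : Fin M, Finset (Fin N × Fin N) → Layers N T → PGDInput N T (fun _ => (m : ℕ) + 1)

/-- `A(E)`: the entries outside the set `E` of observed pairs are set to zero. -/
def mask {N T : ℕ} (E : Finset (Fin N × Fin N)) (A : Layers N T) : Layers N T :=
  fun t i j => if (i, j) ∈ E then A t i j else 0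

/-- The estimated parameters of candidate `m` computed from the pairs in `E`. -/
def fit {N M T : ℕ} (τ : Tuning N M T) (E : Finset (Fin N × Fin N)) (A : Layers N T) (m : Fin M) :
    LatentParams N T (fun _ => (m : ℕ) + 1) :=
  pgd (mask E A) (τ m E (mask E A))

/-! ### Edge splitting -/

/-- A symmetric split of the nodal pairs, given by the set `train` of those unordered pairs
(including `{i, i}`) that are used for training, together with an assignment of the ordered nodal
pairs to `K` groups (only its values on the training pairs matter). -/
structure EdgeSplit (N K : ℕ) where
  train : Finset (Sym2 (Fin N))
  group : Fin N × Fin N → Fin K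

/-- Discrete σ-algebra on the finite type of splits. -/
instance (N K : ℕ) : MeasurableSpace (EdgeSplit N K) := ⊤

/-- `Ψ₁`, a symmetric set of ordered pairs. -/
def EdgeSplit.psi1 {N K : ℕ} (s : EdgeSplit N K) : Finset (Fin N × Fin N) :=
  Finset.univ.filter fun e => s(e.1, e.2) ∈ s.train

/-- `Ψ₂`, the complement of `Ψ₁`. -/
def EdgeSplit.psi2 {N K : ℕ} (s : EdgeSplit N K) : Finset (Fin N × Fin N) :=
  Finset.univ \ s.psi1

/-- `G_k`, the `k`-th group of training pairs. -/
def EdgeSplit.G {N K : ℕ} (s : EdgeSplit N K) (k : Fin K) : Finset (Fin N × Fin N) :=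
  s.psi1.filter fun e => s.group e = k

/-- The fraction `|Ψ₁| / |Ψ|` of training pairs, where `|Ψ| = N ^ 2`. -/
def EdgeSplit.fraction {N K : ℕ} (s : EdgeSplit N K) : ℝ :=
  (s.psi1.card : ℝ) / (N : ℝ) ^ 2

/-- The training pairs are drawn at random: given their number, all sets of unordered pairs are
equally likely. -/
def IsUniformSplit {Ω : Type*} [MeasurableSpace Ω] (μ : Measure Ω) {N K : ℕ}
    (S : Ω → EdgeSplit N K) : Prop :=
  ∀ B B' : Finset (Sym2 (Fin N)), B.card = B'.card →
    μ {ω | (S ω).train = B} = μ {ω | (S ω).train = B'}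

/-! ### Estimated probabilities, cross-validation criterion, losses -/

/-- `P̂_{(m),ij}^{(t)} = f₂(Θ̂_{(m),ij}^{(t)})` with `f₂(x) = |Ψ| / ((1 + exp (-x)) |Ψ₁|)`, where
`Θ̂_{(m)}` is fitted on `Ψ₁`. -/
def pHat {N M T K : ℕ} (τ : Tuning N M T) (s : EdgeSplit N K) (A : Layers N T) (m : Fin M) :
    Layers N T :=
  fun t i j => (N : ℝ) ^ 2 / (s.psi1.card : ℝ) * Real.sigmoid ((fit τ s.psi1 A m).theta t i j)

/-- `P̃_{(m),ij}^{(t)[k]}`: equal to `f₁(Θ̃_{(m),ij}^{(t)[-k]})` for `(i, j) ∈ G_k`, and zero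
elsewhere, with `f₁(x) = K / ((1 + exp (-x)) (K - 1))`, where `Θ̃_{(m)}^{[-k]}` is fitted on
`Ψ₁ \ G_k`. -/
def pTilde {N M T K : ℕ} (τ : Tuning N M T) (s : EdgeSplit N K) (A : Layers N T) (k : Fin K)
    (m : Fin M) : Layers N T :=
  fun t i j => if (i, j) ∈ s.G k then
    (K : ℝ) / ((K : ℝ) - 1) * Real.sigmoid ((fit τ (s.psi1 \ s.G k) A m).theta t i j) else 0

/-- The average `∑_m w_m X_m`. -/
def average {N M T : ℕ} (w : Fin M → ℝ) (X : Fin M → Layers N T) : Layers N T :=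
  fun t i j => ∑ m, w m * X m t i j

/-- The squared distance `∑_t ∑_{(i,j) ∈ E} (X_{ij}^{(t)} - Y_{ij}^{(t)})²`. -/
def sqDist {N T : ℕ} (E : Finset (Fin N × Fin N)) (X Y : Layers N T) : ℝ :=
  ∑ t, ∑ e ∈ E, (X t e.1 e.2 - Y t e.1 e.2) ^ 2

/-- The multi-layer `K`-fold edge cross-validation criterion
`CV†(w) = (T |Ψ₁|)⁻¹ ∑_t ∑_k ‖A^{(t)[k]} - P̃^{(t)[k]}(w)‖_F²`, where `A^{(t)[k]}` is `A^{(t)}`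
with the entries outside `G_k` set to zero. -/
def cv {N M T K : ℕ} (τ : Tuning N M T) (s : EdgeSplit N K) (A : Layers N T) (w : Fin M → ℝ) : ℝ :=
  1 / ((T : ℝ) * (s.psi1.card : ℝ)) * ∑ t, ∑ k, ∑ i, ∑ j,
    (mask (s.G k) A t i j - average w (pTilde τ s A k) t i j) ^ 2

/-- The infimum of a function over the weight simplex `𝒲 = {w ∈ [0,1]^M : ∑ w_m = 1}`. -/
def infW {M : ℕ} (f : (Fin M → ℝ) → ℝ) : ℝ :=
  ⨅ w : stdSimplex ℝ (Fin M), f w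

/-- The loss `∑_t ∑_{(i,j) ∈ E} (P̂_{ij}^{(t)}(w) - P_{ij}^{(t)})²` of the averaging prediction on
the set `E` of pairs. -/
def loss {N M T K : ℕ} (τ : Tuning N M T) (s : EdgeSplit N K) (A P : Layers N T)
    (E : Finset (Fin N × Fin N)) (w : Fin M → ℝ) : ℝ :=
  sqDist E (average w (pHat τ s A)) P

/-- `L†*(w) = ∑_t ∑_{(i,j) ∈ Ψ₁} (P*_{ij}^{(t)}(w) - P_{ij}^{(t)})²`. -/
def limitLoss {N M T K : ℕ} (s : EdgeSplit N K) (Pstar : Fin M → Layers N T) (P : Layers N T)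
    (w : Fin M → ℝ) : ℝ :=
  sqDist s.psi1 (average w Pstar) P

/-- The minimal limiting loss `ξ†* = inf_{w ∈ 𝒲} L†*(w)`. -/
def xiStar {N M T K : ℕ} (s : EdgeSplit N K) (Pstar : Fin M → Layers N T) (P : Layers N T) : ℝ :=
  infW (limitLoss s Pstar P)

/-! ### Stochastic orders -/

/-- `X_n = O_p(R_n)`. -/
def IsBigOInProb {Ω : Type*} [MeasurableSpace Ω] (μ : Measure Ω) (X R : ℕ → Ω → ℝ) : Prop :=
  ∀ ε : ENNReal, 0 < ε → ∃ C : ℝ, ∀ᶠ n in atTop, μ {ω | C * |R n ω| < |X n ω|} ≤ ε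

/-- `X_n = o_p(R_n)`. -/
def IsLittleOInProb {Ω : Type*} [MeasurableSpace Ω] (μ : Measure Ω) (X R : ℕ → Ω → ℝ) : Prop :=
  ∀ c : ℝ, 0 < c → Tendsto (fun n => μ {ω | c * |R n ω| < |X n ω|}) atTop (𝓝 0)

end

end NetMA

/-! The limiting predictions are nonrandom, so the criterion can be compared with their loss. They
are first truncated entrywise to `[0, B]`, giving arrays `Q`. The leave-out fits lie in `[0, 2]`, so
projection onto `[0, B]` with `B ≥ 2` keeps `Q` within `O_p(NMT) = o_p(ξ)` of both the fits and the
original limits, while making `Q` bounded.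

With `P̃(w)` the averaged leave-out fits, and up to a positive factor, the criterion is `‖A - P‖² +
‖P̃(w) - P‖² - 2⟨A - P, P̃(w) - Q(w)⟩ - 2⟨A - P, Q(w) - P⟩` on `Ψ₁` (`sqDist_expand`). The first
term is free of `w`, and the second is close to the loss of `Q(w)`. The third involves fits that
depend on `A`, so only Cauchy–Schwarz is available: `‖A - P‖² = O_p(N D T) = O_p(ξ)` against
`o_p(ξ)`. The fourth is linear in `w` with bounded nonrandom coefficients. A variance bound at the
`M` vertices, after freezing the independent split, gives `O_p(NMT)` uniformly over the simplex. All
errors are small relative to the loss of `Q(w)`, which is at least `ξ / 2`. Hence the selected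
weights nearly minimize that loss, and so the loss of the full fits (`criterion_minimizer`,
`cv_minimizer`).

For `Ψ₂`, the loss of `Q(w)` is a quadratic form in `w` whose coefficients are `M²` inner products
of fixed arrays. Exchangeable sampling makes each such product over `Ψ₁` concentrate around `r`
times the total, where `r` is the sampling rate of unordered pairs (`sum_sq_sampling_le`). Thus the
loss on `Ψ₂` is `(1 - r) / r` times that on `Ψ₁` up to `o_p(ξ)`, uniformly in `w`, and
near-minimality transfers (`test_loss_ratio`). -/

namespace NetMA

/-! ### Squared distances and inner products on a set of pairs -/

/-- The inner product `∑_t ∑_{(i,j) ∈ E} X_{ij}^{(t)} Y_{ij}^{(t)}`. -/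
noncomputable def innerOn {N T : ℕ} (E : Finset (Fin N × Fin N)) (X Y : Layers N T) : ℝ :=
  ∑ t, ∑ e ∈ E, X t e.1 e.2 * Y t e.1 e.2

section Deterministic

variable {N M T : ℕ} {E : Finset (Fin N × Fin N)}

lemma sqDist_nonneg (E : Finset (Fin N × Fin N)) (X Y : Layers N T) : 0 ≤ sqDist E X Y :=
  Finset.sum_nonneg fun _ _ => Finset.sum_nonneg fun _ _ => sq_nonneg _

lemma sqDist_mono {X Y X' Y' : Layers N T}
    (h : ∀ t, ∀ e ∈ E, |X t e.1 e.2 - Y t e.1 e.2| ≤ |X' t e.1 e.2 - Y' t e.1 e.2|) :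
    sqDist E X Y ≤ sqDist E X' Y' :=
  Finset.sum_le_sum fun t _ => Finset.sum_le_sum fun e he => sq_le_sq.2 (h t e he)

lemma sqDist_mono_set {E F : Finset (Fin N × Fin N)} (h : E ⊆ F) (X Y : Layers N T) :
    sqDist E X Y ≤ sqDist F X Y :=
  Finset.sum_le_sum fun _ _ =>
    Finset.sum_le_sum_of_subset_of_nonneg h fun _ _ _ => sq_nonneg _

lemma sqDist_triangle (X Y Z : Layers N T) :
    sqDist E X Z ≤ 2 * sqDist E X Y + 2 * sqDist E Y Z := by
  simp only [sqDist, Finset.mul_sum, ← Finset.sum_add_distrib]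
  refine Finset.sum_le_sum fun t _ => Finset.sum_le_sum fun e _ => ?_
  nlinarith [sq_nonneg ((X t e.1 e.2 - Y t e.1 e.2) - (Y t e.1 e.2 - Z t e.1 e.2))]

lemma sqDist_comm (X Y : Layers N T) : sqDist E X Y = sqDist E Y X :=
  Finset.sum_congr rfl fun _ _ => Finset.sum_congr rfl fun _ _ => by ring

/-- Entrywise weighted Young inequality: with `u = X - Y` and `v = Y - Z`, the cross term `2uv` is
absorbed using `(η|v| - |u|)² / η ≥ 0`. -/
lemma abs_sqDist_sub_le {η : ℝ} (hη : 0 < η) (X Y Z : Layers N T) :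
    |sqDist E X Z - sqDist E Y Z| ≤ η * sqDist E Y Z + (1 + 1 / η) * sqDist E X Y := by
  simp only [sqDist, Finset.mul_sum, ← Finset.sum_add_distrib, ← Finset.sum_sub_distrib]
  refine (Finset.abs_sum_le_sum_abs _ _).trans (Finset.sum_le_sum fun t _ => ?_)
  refine (Finset.abs_sum_le_sum_abs _ _).trans (Finset.sum_le_sum fun e _ => ?_)
  set u := X t e.1 e.2 - Y t e.1 e.2
  set v := Y t e.1 e.2 - Z t e.1 e.2
  have hu : X t e.1 e.2 - Z t e.1 e.2 = u + v := by simp [u, v]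
  have h1 : 2 * |u * v| ≤ η * v ^ 2 + 1 / η * u ^ 2 := by
    have h := sq_nonneg (η * |v| - |u|)
    have : 0 ≤ (η * |v| - |u|) ^ 2 / η := by positivity
    have h2 : (η * |v| - |u|) ^ 2 / η = η * v ^ 2 + 1 / η * u ^ 2 - 2 * |u * v| := by
      rw [abs_mul, ← sq_abs u, ← sq_abs v]; field_simp; ring
    linarith
  rw [hu, abs_le]
  have := abs_le.1 (le_refl |u * v|)
  constructor <;> nlinarith [sq_nonneg u]

lemma abs_sqDist_sub_le_mul {ε : ℝ} (h0 : 0 < ε) (h1 : ε ≤ 1) {X Y Z : Layers N T}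
    (h : sqDist E X Y ≤ ε ^ 2 / 8 * sqDist E Y Z) :
    |sqDist E X Z - sqDist E Y Z| ≤ ε * sqDist E Y Z := by
  -- With `η = ε / 2` the second coefficient times `ε² / 8` is `ε² / 8 + ε / 4`, which is below `ε /
  -- 2` since `ε ≤ 1`.
  refine (abs_sqDist_sub_le (half_pos h0) X Y Z).trans ?_
  have h2 : (1 + 1 / (ε / 2)) * sqDist E X Y ≤
      (1 + 1 / (ε / 2)) * (ε ^ 2 / 8 * sqDist E Y Z) := by gcongr
  have h3 : (1 + 1 / (ε / 2)) * (ε ^ 2 / 8 * sqDist E Y Z) =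
      (ε ^ 2 / 8 + ε / 4) * sqDist E Y Z := by field_simp; ring
  have h4 := sqDist_nonneg E Y Z
  have h5 : (ε ^ 2 / 8 + ε / 4) * sqDist E Y Z ≤ (ε / 2) * sqDist E Y Z := by
    gcongr; nlinarith
  linarith

lemma sq_innerOn_le (A P X Y : Layers N T) :
    innerOn E (A - P) (X - Y) ^ 2 ≤ sqDist E A P * sqDist E X Y := by
  simp only [innerOn, sqDist, ← Finset.sum_product']
  exact Finset.sum_mul_sq_le_sq_mul_sq _ _ _

lemma average_sub (w : Fin M → ℝ) (hw : w ∈ stdSimplex ℝ (Fin M)) (X : Fin M → Layers N T)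
    (P : Layers N T) (t : Fin T) (i j : Fin N) :
    average w X t i j - P t i j = ∑ m, w m * (X m t i j - P t i j) := by
  simp only [average, mul_sub, Finset.sum_sub_distrib, ← Finset.sum_mul, hw.2, one_mul]

/-- Convexity of the square: control at the vertices is control on the whole simplex, so no covering
argument over the weights is needed. -/
lemma sqDist_average_le {w : Fin M → ℝ} (hw : w ∈ stdSimplex ℝ (Fin M))
    {X Y : Fin M → Layers N T} {c : ℝ} (h : ∀ m, sqDist E (X m) (Y m) ≤ c) :
    sqDist E (average w X) (average w Y) ≤ c := by
  have h1 : sqDist E (average w X) (average w Y) ≤ ∑ m, w m * sqDist E (X m) (Y m) := by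
    simp only [sqDist, Finset.mul_sum]
    rw [Finset.sum_comm (γ := Fin M)]
    refine Finset.sum_le_sum fun t _ => ?_
    rw [Finset.sum_comm (γ := Fin M)]
    refine Finset.sum_le_sum fun e _ => ?_
    have := (even_two.convexOn_pow (𝕜 := ℝ)).map_sum_le (t := Finset.univ) (w := w)
      (p := fun m => X m t e.1 e.2 - Y m t e.1 e.2) (fun m _ => hw.1 m) hw.2 (by simp)
    simpa [average, ← Finset.sum_sub_distrib, mul_sub] using this
  calc _ ≤ ∑ m, w m * sqDist E (X m) (Y m) := h1
    _ ≤ ∑ m, w m * c := Finset.sum_le_sum fun m _ => mul_le_mul_of_nonneg_left (h m) (hw.1 m)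
    _ = c := by rw [← Finset.sum_mul, hw.2, one_mul]

lemma abs_sum_weight_le {w : Fin M → ℝ} (hw : w ∈ stdSimplex ℝ (Fin M)) {x : Fin M → ℝ} {c : ℝ}
    (h : ∀ m, |x m| ≤ c) : |∑ m, w m * x m| ≤ c := by
  calc |∑ m, w m * x m| ≤ ∑ m, |w m * x m| := Finset.abs_sum_le_sum_abs _ _
    _ ≤ ∑ m, w m * c := Finset.sum_le_sum fun m _ => by
        rw [abs_mul, abs_of_nonneg (hw.1 m)]
        exact mul_le_mul_of_nonneg_left (h m) (hw.1 m)
    _ = c := by rw [← Finset.sum_mul, hw.2, one_mul]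

lemma innerOn_average_sub {w : Fin M → ℝ} (hw : w ∈ stdSimplex ℝ (Fin M))
    (R : Layers N T) (Q : Fin M → Layers N T) (P : Layers N T) :
    innerOn E R (average w Q - P) = ∑ m, w m * innerOn E R (Q m - P) := by
  simp only [innerOn, Pi.sub_apply, average_sub w hw, Finset.mul_sum]
  rw [Finset.sum_comm (γ := Fin M)]
  refine Finset.sum_congr rfl fun t _ => ?_
  rw [Finset.sum_comm (γ := Fin M)]
  exact Finset.sum_congr rfl fun t _ => Finset.sum_congr rfl fun t _ => by ring

/-- Since the weights sum to one, `P` can be moved inside the average. Only `M²` weight-free inner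
products then remain to be controlled. -/
lemma sqDist_average_eq {w : Fin M → ℝ} (hw : w ∈ stdSimplex ℝ (Fin M))
    (Q : Fin M → Layers N T) (P : Layers N T) :
    sqDist E (average w Q) P = ∑ m, w m * ∑ m', w m' * innerOn E (Q m - P) (Q m' - P) := by
  have h : sqDist E (average w Q) P = innerOn E (average w Q - P) (average w Q - P) := by
    simp only [sqDist, innerOn, Pi.sub_apply, sq]
  have hc : ∀ X Y : Layers N T, innerOn E X Y = innerOn E Y X := fun X Y => by
    simp only [innerOn]
    exact Finset.sum_congr rfl fun t _ => Finset.sum_congr rfl fun e _ => mul_comm _ _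
  rw [h, innerOn_average_sub hw]
  refine Finset.sum_congr rfl fun m _ => ?_
  rw [hc, innerOn_average_sub hw]

/-- The intermediate `Q` splits the interaction with the noise into a part depending on the data,
left to Cauchy–Schwarz, and a part with fixed coefficients, left to a variance bound. -/
lemma sqDist_expand (A P Y Q : Layers N T) :
    sqDist E A Y = sqDist E A P + sqDist E Y P - 2 * innerOn E (A - P) (Y - Q)
      - 2 * innerOn E (A - P) (Q - P) := by
  simp only [sqDist, innerOn, Finset.mul_sum, ← Finset.sum_add_distrib, ← Finset.sum_sub_distrib,
    Pi.sub_apply]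
  exact Finset.sum_congr rfl fun t _ => Finset.sum_congr rfl fun e _ => by ring

/-! ### Comparison of the criterion with the losses -/

/-- If the limits `Q` are uniformly close to the limits `Pstar`, to the leave-out fits `Pt` and to
the full fits `Ph`, and the noise `A - P` is nearly orthogonal to `Q - P`, then the full loss is
close to the loss of `Q`, and a minimizer of the criterion nearly minimizes the latter. -/
lemma criterion_minimizer {A P : Layers N T} {Ph Pt Pstar Q : Fin M → Layers N T}
    {wHat : Fin M → ℝ} (hw : wHat ∈ stdSimplex ℝ (Fin M))
    (hmin : ∀ w ∈ stdSimplex ℝ (Fin M),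
      sqDist E A (average wHat Pt) ≤ sqDist E A (average w Pt))
    {ξ ε : ℝ} (hξ : 0 < ξ) (hε : 0 < ε) (hε2 : ε ≤ 1 / 2)
    (hξw : ∀ w ∈ stdSimplex ℝ (Fin M), ξ ≤ sqDist E (average w Pstar) P)
    (hQ : ∀ m, sqDist E (Q m) (Pstar m) ≤ ε ^ 2 / 64 * ξ)
    (hPt : ∀ m, sqDist E (Pt m) (Q m) ≤ ε ^ 2 / 64 * ξ)
    (hPh : ∀ m, sqDist E (Ph m) (Q m) ≤ ε ^ 2 / 16 * ξ)
    (hnoise : ∀ m, |innerOn E (A - P) (Q m - P)| ≤ ε ^ 2 / 64 * ξ)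
    (hcross : ∀ w ∈ stdSimplex ℝ (Fin M),
      |innerOn E (A - P) (average w Pt - average w Q)| ≤ ε ^ 2 / 64 * ξ) :
    (∀ w ∈ stdSimplex ℝ (Fin M), ξ ≤ 2 * sqDist E (average w Q) P) ∧
    (∀ w ∈ stdSimplex ℝ (Fin M),
      |sqDist E (average w Ph) P - sqDist E (average w Q) P| ≤ ε * sqDist E (average w Q) P) ∧
    (∀ w ∈ stdSimplex ℝ (Fin M),
      (1 - 2 * ε) * sqDist E (average wHat Q) P ≤ (1 + 2 * ε) * sqDist E (average w Q) P) := by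
  have h2 : ∀ w ∈ stdSimplex ℝ (Fin M), ξ ≤ 2 * sqDist E (average w Q) P := by
    intro w hw
    have h1 := hξw w hw
    have h := abs_sqDist_sub_le_mul (E := E) hε (by linarith) (X := average w Q)
      (Y := average w Pstar) (Z := P) ((sqDist_average_le hw hQ).trans (by
        have : 0 ≤ ε ^ 2 := sq_nonneg _
        nlinarith))
    have := (abs_le.1 h).1
    nlinarith
  have hs : 0 ≤ ε ^ 2 := sq_nonneg _
  have h3 : ∀ w ∈ stdSimplex ℝ (Fin M), |sqDist E (average w Pt) P - sqDist E (average w Q) P| ≤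
      ε * sqDist E (average w Q) P := fun w hw =>
    abs_sqDist_sub_le_mul hε (by linarith) ((sqDist_average_le hw hPt).trans (by
      have := h2 w hw
      nlinarith))
  have h4 : ∀ w ∈ stdSimplex ℝ (Fin M),
      |sqDist E A (average w Pt) - sqDist E A P - sqDist E (average w Q) P| ≤
      2 * ε * sqDist E (average w Q) P := by
    intro w hw
    have a1 := abs_le.1 (h3 w hw)
    have a2 := abs_le.1 (hcross w hw)
    have a3 := abs_le.1 (abs_sum_weight_le hw hnoise)
    rw [← innerOn_average_sub hw] at a3
    -- The two noise terms enter with factor 2 and cost `ε / 16` each; together with `ε` from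
    -- replacing the fits by `Q` this stays below `2ε`.
    have a4 : ε ^ 2 / 64 * ξ ≤ ε / 32 * sqDist E (average w Q) P := by
      have := h2 w hw
      have : ε ^ 2 / 64 * ξ ≤ ε / 64 * ξ := by gcongr; nlinarith
      nlinarith
    rw [sqDist_expand A P (average w Pt) (average w Q), abs_le]
    have a5 := mul_nonneg hε.le (sqDist_nonneg E (average w Q) P)
    constructor <;> nlinarith
  refine ⟨h2, fun w hw => abs_sqDist_sub_le_mul hε (by linarith)
    ((sqDist_average_le hw hPh).trans (by have := h2 w hw; nlinarith)), fun w hw' => ?_⟩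
  have b1 := abs_le.1 (h4 w hw')
  have b2 := abs_le.1 (h4 wHat hw)
  have b3 := hmin w hw'
  linarith

/-! ### Passing to the infimum over the weights -/

lemma infW_le {f : (Fin M → ℝ) → ℝ} (hf : ∀ w, 0 ≤ f w) {w : Fin M → ℝ}
    (hw : w ∈ stdSimplex ℝ (Fin M)) : infW f ≤ f w :=
  ciInf_le (f := fun w : stdSimplex ℝ (Fin M) => f w) ⟨0, by rintro _ ⟨w, rfl⟩; exact hf _⟩ ⟨w, hw⟩

/-- The ratio is at least one because `wHat` is itself admissible. The bound `κ` serves only to keep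
the infimum away from zero. -/
lemma abs_div_infW_sub_one_le {f : (Fin M → ℝ) → ℝ} {wHat : Fin M → ℝ}
    (hw : wHat ∈ stdSimplex ℝ (Fin M)) {κ ε : ℝ} (hκ : 0 < κ) (hε : 0 < ε)
    (hpos : ∀ w ∈ stdSimplex ℝ (Fin M), κ ≤ f w)
    (hmin : ∀ w ∈ stdSimplex ℝ (Fin M), f wHat ≤ (1 + ε) * f w) :
    |f wHat / infW f - 1| ≤ ε := by
  have : Nonempty (stdSimplex ℝ (Fin M)) := ⟨⟨wHat, hw⟩⟩
  have h1 : κ ≤ infW f := le_ciInf fun w => hpos w w.2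
  have h2 : infW f ≤ f wHat := ciInf_le (f := fun w : stdSimplex ℝ (Fin M) => f w)
    ⟨κ, by rintro _ ⟨w, rfl⟩; exact hpos _ w.2⟩ ⟨wHat, hw⟩
  have h3 : f wHat / (1 + ε) ≤ infW f := le_ciInf fun w => by
    rw [div_le_iff₀' (by linarith)]; exact hmin w w.2
  rw [div_le_iff₀ (by linarith)] at h3
  have h0 : 0 < infW f := hκ.trans_le h1
  rw [abs_le]
  constructor
  · have : 1 ≤ f wHat / infW f := by rwa [le_div_iff₀ h0, one_mul]
    linarith
  · have : f wHat / infW f ≤ 1 + ε := by rw [div_le_iff₀ h0]; linarith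
    linarith

/-! ### Truncation -/

/-- Truncation of every entry to the interval `[0, B]`. -/
noncomputable def clip (B : ℝ) (X : Layers N T) : Layers N T :=
  fun t i j => max 0 (min B (X t i j))

/-- Projection onto `[0, B]` is nonexpansive and fixes `y`. -/
lemma abs_sub_clip_le {B x y : ℝ} (h0 : 0 ≤ y) (hB : y ≤ B) :
    |y - max 0 (min B x)| ≤ |y - x| := by
  rcases le_total x 0 with h | h
  · rw [max_eq_left (min_le_of_right_le h), abs_of_nonneg (by linarith), abs_of_nonneg (by linarith)]
    linarith
  · rw [max_eq_right (le_min (by linarith) h)]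
    rcases le_total B x with h' | h'
    · rw [min_eq_left h', abs_of_nonpos (by linarith), abs_of_nonpos (by linarith)]
      linarith
    · rw [min_eq_right h']

/-- The projection is the point of `[0, B]` nearest to `x`, and `y` is a competitor. -/
lemma abs_clip_sub_le {B x y : ℝ} (h0 : 0 ≤ y) (hB : y ≤ B) :
    |max 0 (min B x) - x| ≤ |y - x| := by
  rcases le_total x 0 with h | h
  · rw [max_eq_left (min_le_of_right_le h), abs_of_nonneg (by linarith), abs_of_nonneg (by linarith)]
    linarith
  · rw [max_eq_right (le_min (by linarith) h)]
    rcases le_total B x with h' | h'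
    · rw [min_eq_left h', abs_of_nonpos (by linarith), abs_of_nonpos (by linarith)]
      linarith
    · rw [min_eq_right h']; simp

/-- The reason for truncating: the variance bounds need bounded coefficients, whereas the limiting
values are arbitrary reals. -/
lemma abs_clip_sub_le_of_mem {B : ℝ} (hB : 1 ≤ B) (X P : Layers N T) (t : Fin T) (i j : Fin N)
    (h0 : 0 ≤ P t i j) (h1 : P t i j ≤ 1) : |(clip B X - P) t i j| ≤ B := by
  simp only [clip, Pi.sub_apply]
  have h2 : max 0 (min B (X t i j)) ≤ B := max_le (by linarith) (min_le_left _ _)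
  have h3 : 0 ≤ max 0 (min B (X t i j)) := le_max_left _ _
  rw [abs_le]; constructor <;> linarith

/-! ### The cross-validation criterion as a squared distance -/

variable {K : ℕ}

/-- The leave-one-group-out predictions put together to one array on `Ψ₁`. -/
noncomputable def pTildeAll (τ : Tuning N M T) (s : EdgeSplit N K) (A : Layers N T) (m : Fin M) :
    Layers N T := fun t i j => pTilde τ s A (s.group (i, j)) m t i j

lemma EdgeSplit.sum_G (s : EdgeSplit N K) (f : Fin K → Fin N × Fin N → ℝ) :
    ∑ k, ∑ e ∈ s.G k, f k e = ∑ e ∈ s.psi1, f (s.group e) e := by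
  simp only [EdgeSplit.G, Finset.sum_filter]
  rw [Finset.sum_comm]
  exact Finset.sum_congr rfl fun e _ => by simp

lemma sum_sqDist_pTilde (τ : Tuning N M T) (s : EdgeSplit N K) (A X : Layers N T) (m : Fin M) :
    ∑ k, sqDist (s.G k) (pTilde τ s A k m) X = sqDist s.psi1 (pTildeAll τ s A m) X := by
  simp only [sqDist]
  rw [Finset.sum_comm]
  exact Finset.sum_congr rfl fun t _ =>
    s.sum_G fun k e => (pTilde τ s A k m t e.1 e.2 - X t e.1 e.2) ^ 2

/-- The groups partition `Ψ₁`, and outside `G_k` both the masked data and `Y k` vanish, so each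
training pair is counted exactly once. -/
lemma sum_mask_sub_sq (s : EdgeSplit N K) (A : Layers N T) (Y : Fin K → Layers N T)
    (hY : ∀ k t e, e ∉ s.G k → Y k t e.1 e.2 = 0) :
    ∑ t, ∑ k, ∑ i, ∑ j, (mask (s.G k) A t i j - Y k t i j) ^ 2 =
      sqDist s.psi1 A (fun t i j => Y (s.group (i, j)) t i j) := by
  refine Finset.sum_congr rfl fun t _ => ?_
  refine Eq.trans ?_ (s.sum_G fun k e => (A t e.1 e.2 - Y k t e.1 e.2) ^ 2)
  refine Finset.sum_congr rfl fun k _ => ?_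
  rw [← Fintype.sum_prod_type' (f := fun i j => (mask (s.G k) A t i j - Y k t i j) ^ 2)]
  symm
  refine (Finset.sum_congr rfl fun e he => ?_).trans
    (Finset.sum_subset (Finset.subset_univ (s.G k)) fun e _ he => ?_)
  · simp [mask, he]
  · simp [mask, he, hY k t e he]

lemma pTilde_eq_zero (τ : Tuning N M T) (s : EdgeSplit N K) (A : Layers N T) (k : Fin K)
    (m : Fin M) (t : Fin T) {e : Fin N × Fin N} (he : e ∉ s.G k) :
    pTilde τ s A k m t e.1 e.2 = 0 := by
  rw [pTilde, if_neg he]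

lemma cv_eq (τ : Tuning N M T) (s : EdgeSplit N K) (A : Layers N T) (w : Fin M → ℝ) :
    cv τ s A w = 1 / ((T : ℝ) * (s.psi1.card : ℝ)) *
      sqDist s.psi1 A (average w (pTildeAll τ s A)) := by
  rw [cv, sum_mask_sub_sq s A (fun k => average w (pTilde τ s A k))]
  · have : average w (pTildeAll τ s A) =
        fun t i j => average w (pTilde τ s A (s.group (i, j))) t i j := by
      funext t i j
      simp only [average, pTildeAll]
    rw [this]
  · intro k t e he
    simp only [average, pTilde_eq_zero τ s A k _ t he, mul_zero, Finset.sum_const_zero]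

lemma pTildeAll_nonneg (hK : 2 ≤ K) (τ : Tuning N M T) (s : EdgeSplit N K) (A : Layers N T)
    (m : Fin M) (t : Fin T) (i j : Fin N) : 0 ≤ pTildeAll τ s A m t i j := by
  have : (2 : ℝ) ≤ K := by exact_mod_cast hK
  simp only [pTildeAll, pTilde]
  split_ifs
  · exact mul_nonneg (div_nonneg (by linarith) (by linarith)) (Real.sigmoid_nonneg _)
  · rfl

lemma pTildeAll_le (hK : 2 ≤ K) (τ : Tuning N M T) (s : EdgeSplit N K) (A : Layers N T)
    (m : Fin M) (t : Fin T) (i j : Fin N) : pTildeAll τ s A m t i j ≤ 2 := by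
  have hK' : (2 : ℝ) ≤ K := by exact_mod_cast hK
  simp only [pTildeAll, pTilde]
  split_ifs
  · have h1 : (K : ℝ) / ((K : ℝ) - 1) ≤ 2 := by rw [div_le_iff₀ (by linarith)]; linarith
    have h2 := Real.sigmoid_le_one ((fit τ (s.psi1 \ s.G (s.group (i, j))) A m).theta t i j)
    have h3 := Real.sigmoid_nonneg ((fit τ (s.psi1 \ s.G (s.group (i, j))) A m).theta t i j)
    nlinarith
  · norm_num

lemma pHat_nonneg (τ : Tuning N M T) (s : EdgeSplit N K) (A : Layers N T)
    (m : Fin M) (t : Fin T) (i j : Fin N) : 0 ≤ pHat τ s A m t i j :=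
  mul_nonneg (by positivity) (Real.sigmoid_nonneg _)

/-- Needed on `Ψ₂` only, where no leave-out fit is available to justify the truncation. -/
lemma pHat_le {c : ℝ} (hc : 0 < c) (τ : Tuning N M T) (s : EdgeSplit N K) (hs : c ≤ s.fraction)
    (A : Layers N T) (m : Fin M) (t : Fin T) (i j : Fin N) : pHat τ s A m t i j ≤ 1 / c := by
  have h1 : (N : ℝ) ^ 2 / (s.psi1.card : ℝ) ≤ 1 / c := by
    have : (N : ℝ) ^ 2 / (s.psi1.card : ℝ) = 1 / s.fraction := by simp [EdgeSplit.fraction]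
    rw [this]
    exact one_div_le_one_div_of_le hc hs
  have h2 := Real.sigmoid_le_one ((fit τ s.psi1 A m).theta t i j)
  have h3 := Real.sigmoid_nonneg ((fit τ s.psi1 A m).theta t i j)
  exact (mul_le_of_le_one_right (by positivity) h2).trans h1

end Deterministic

/-! ### Events of high probability and stochastic orders -/

section StochasticOrders

variable {Ω : Type*} [MeasurableSpace Ω] {μ : Measure Ω}

/-- The event `p n` has (outer) probability tending to one. -/
def WithHighProb (μ : Measure Ω) (p : ℕ → Ω → Prop) : Prop :=
  Tendsto (fun n => μ {ω | ¬ p n ω}) atTop (𝓝 0)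

lemma WithHighProb.mono {p q : ℕ → Ω → Prop} (hp : WithHighProb μ p)
    (h : ∀ n ω, p n ω → q n ω) : WithHighProb μ q :=
  tendsto_of_tendsto_of_tendsto_of_le_of_le tendsto_const_nhds hp (fun _ => zero_le)
    fun n => measure_mono fun ω hω hp' => hω (h n ω hp')

lemma WithHighProb.and {p q : ℕ → Ω → Prop} (hp : WithHighProb μ p) (hq : WithHighProb μ q) :
    WithHighProb μ fun n ω => p n ω ∧ q n ω := by
  have h := Tendsto.add hp hq
  rw [add_zero] at h
  refine tendsto_of_tendsto_of_tendsto_of_le_of_le tendsto_const_nhds h (fun _ => zero_le)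
    fun n => (measure_mono fun ω hω => ?_).trans (measure_union_le _ _)
  simp only [Set.mem_ofPred_eq, not_and_or] at hω
  exact hω

lemma tendstoInMeasure_of_withHighProb {f : ℕ → Ω → ℝ} {a : ℝ}
    (h : ∀ ε : ℝ, 0 < ε → ε ≤ 1 → WithHighProb μ fun n ω => |f n ω - a| ≤ ε) :
    TendstoInMeasure μ f atTop fun _ => a := by
  rw [tendstoInMeasure_iff_norm]
  intro ε hε
  -- Halving `ε` turns the weak inequality into a strict one; the minimum with 1 meets the
  -- restriction `ε ≤ 1` in `h`.
  refine ((h (min (ε / 2) 1) (by positivity) (min_le_right _ _)).mono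
    (q := fun n ω => ¬ ε ≤ ‖f n ω - a‖) fun n ω hω => ?_).congr fun n => by simp
  rw [Real.norm_eq_abs, not_le]
  linarith [min_le_left (ε / 2) 1]

lemma IsLittleOInProb.withHighProb {X R : ℕ → Ω → ℝ} (h : IsLittleOInProb μ X R) {c : ℝ}
    (hc : 0 < c) : WithHighProb μ fun n ω => |X n ω| ≤ c * |R n ω| := by
  simpa only [WithHighProb, not_le] using h c hc

lemma IsBigOInProb.exists_pos {X R : ℕ → Ω → ℝ} (h : IsBigOInProb μ X R) {ε : ENNReal}
    (hε : 0 < ε) : ∃ C : ℝ, 0 < C ∧ ∀ᶠ n in atTop, μ {ω | C * |R n ω| < |X n ω|} ≤ ε := by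
  obtain ⟨C, hC⟩ := h ε hε
  refine ⟨max C 1, by positivity, hC.mono fun n hn => (measure_mono fun ω hω => ?_).trans hn⟩
  simp only [Set.mem_ofPred_eq] at hω ⊢
  exact (mul_le_mul_of_nonneg_right (le_max_left C 1) (abs_nonneg _)).trans_lt hω

lemma IsBigOInProb.trans {X Y Z : ℕ → Ω → ℝ} (h : IsBigOInProb μ X Y) (h' : IsBigOInProb μ Y Z) :
    IsBigOInProb μ X Z := fun ε hε => by
  obtain ⟨C, hC0, hC⟩ := h.exists_pos (ENNReal.half_pos hε.ne')
  obtain ⟨C', -, hC'⟩ := h'.exists_pos (ENNReal.half_pos hε.ne')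
  refine ⟨C * C', ?_⟩
  filter_upwards [hC, hC'] with n h1 h2
  rw [← ENNReal.add_halves ε]
  refine (measure_mono fun ω hω => ?_).trans ((measure_union_le _ _).trans (add_le_add h1 h2))
  by_contra hn
  simp only [Set.mem_union, Set.mem_ofPred_eq, not_or, not_lt] at hn hω
  have := mul_le_mul_of_nonneg_left hn.2 hC0.le
  linarith [hn.1]

lemma IsBigOInProb.trans_isLittleOInProb {X Y Z : ℕ → Ω → ℝ} (h : IsBigOInProb μ X Y)
    (h' : IsLittleOInProb μ Y Z) : IsLittleOInProb μ X Z := fun c hc => by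
  rw [ENNReal.tendsto_nhds_zero]
  intro ε hε
  obtain ⟨C, hC0, hC⟩ := h.exists_pos (ENNReal.half_pos hε.ne')
  have hC' := ENNReal.tendsto_nhds_zero.1 (h' (c / C) (by positivity)) _
    (ENNReal.half_pos hε.ne')
  filter_upwards [hC, hC'] with n h1 h2
  rw [← ENNReal.add_halves ε]
  refine (measure_mono fun ω hω => ?_).trans ((measure_union_le _ _).trans (add_le_add h1 h2))
  by_contra hn
  simp only [Set.mem_union, Set.mem_ofPred_eq, not_or, not_lt] at hn hω
  have := mul_le_mul_of_nonneg_left hn.2 hC0.le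
  have h3 : C * (c / C * |Z n ω|) = c * |Z n ω| := by field_simp
  linarith [hn.1]

lemma IsBigOInProb.sqrt {X R : ℕ → Ω → ℝ} (h : IsBigOInProb μ X fun n ω => R n ω ^ 2) :
    IsBigOInProb μ (fun n ω => √(X n ω)) R := fun ε hε => by
  obtain ⟨C, hC0, hC⟩ := h.exists_pos hε
  refine ⟨√C, hC.mono fun n hn => (measure_mono fun ω hω => ?_).trans hn⟩
  simp only [Set.mem_ofPred_eq] at hω ⊢
  rw [abs_of_nonneg (Real.sqrt_nonneg _)] at hω
  have h1 : 0 < X n ω := Real.sqrt_pos.1 ((by positivity : 0 ≤ √C * |R n ω|).trans_lt hω)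
  rw [Real.lt_sqrt (by positivity), mul_pow, Real.sq_sqrt hC0.le] at hω
  rwa [abs_of_pos h1, abs_pow]

/-- The form in which Cauchy–Schwarz is used. If `X` is bounded with constant `C`, the tolerance `c²
/ C` for `Z` makes the product at most `(cY)²`. -/
lemma IsBigOInProb.sqrt_mul {X Z Y : ℕ → Ω → ℝ} (h : IsBigOInProb μ X Y)
    (h' : IsLittleOInProb μ Z Y) : IsLittleOInProb μ (fun n ω => √(X n ω * Z n ω)) Y :=
  fun c hc => by
  rw [ENNReal.tendsto_nhds_zero]
  intro ε hε
  obtain ⟨C, hC0, hC⟩ := h.exists_pos (ENNReal.half_pos hε.ne')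
  have hC' := ENNReal.tendsto_nhds_zero.1 (h' (c ^ 2 / C) (by positivity)) _
    (ENNReal.half_pos hε.ne')
  filter_upwards [hC, hC'] with n h1 h2
  rw [← ENNReal.add_halves ε]
  refine (measure_mono fun ω hω => ?_).trans ((measure_union_le _ _).trans (add_le_add h1 h2))
  by_contra hn
  simp only [Set.mem_union, Set.mem_ofPred_eq, not_or, not_lt] at hn hω
  rw [abs_of_nonneg (Real.sqrt_nonneg _), Real.lt_sqrt (by positivity)] at hω
  have h3 : |X n ω| * |Z n ω| ≤ (C * |Y n ω|) * (c ^ 2 / C * |Y n ω|) :=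
    mul_le_mul hn.1 hn.2 (abs_nonneg _) (by positivity)
  have h4 : (C * |Y n ω|) * (c ^ 2 / C * |Y n ω|) = (c * |Y n ω|) ^ 2 := by field_simp
  have h5 := le_abs_self (X n ω * Z n ω)
  rw [abs_mul] at h5
  linarith

/-- Markov's inequality in terms of stochastic orders. -/
lemma isBigOInProb_of_lintegral_le {X R : ℕ → Ω → ℝ} {r : ℕ → ℝ} {C : ℝ} (hC : 0 < C)
    (hX : ∀ n, AEMeasurable (X n) μ) (hX0 : ∀ n ω, 0 ≤ X n ω) (hr : ∀ n, 0 ≤ r n)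
    (hR : ∀ n ω, r n ≤ |R n ω|)
    (h : ∀ n, ∫⁻ ω, ENNReal.ofReal (X n ω) ∂μ ≤ ENNReal.ofReal (C * r n)) :
    IsBigOInProb μ X R := fun ε hε => by
  rcases eq_or_ne ε ⊤ with rfl | hε'
  · exact ⟨0, .of_forall fun _ => le_top⟩
  have he : 0 < ε.toReal := ENNReal.toReal_pos hε.ne' hε'
  refine ⟨C / ε.toReal, .of_forall fun n => ?_⟩
  have hsub : {ω | C / ε.toReal * |R n ω| < |X n ω|} ⊆ {ω | C / ε.toReal * r n < X n ω} :=
    fun ω hω => by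
    simp only [Set.mem_ofPred_eq, abs_of_nonneg (hX0 n ω)] at hω ⊢
    exact (mul_le_mul_of_nonneg_left (hR n ω) (by positivity)).trans_lt hω
  refine (measure_mono hsub).trans ?_
  -- Markov's inequality would divide by `r n`. When it is zero, the integral bound forces `X n = 0`
  -- almost everywhere instead.
  rcases (hr n).eq_or_lt with h0 | h0
  · have h1 : ∫⁻ ω, ENNReal.ofReal (X n ω) ∂μ = 0 := by
      simpa [← h0] using h n
    rw [lintegral_eq_zero_iff' (hX n).ennreal_ofReal] at h1
    have h2 : μ {ω | C / ε.toReal * r n < X n ω} = 0 := by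
      refine measure_mono_null (fun ω hω => ?_) (ae_iff.1 h1)
      simp only [Set.mem_ofPred_eq, ← h0, mul_zero] at hω
      simpa using hω
    rw [h2]; exact zero_le
  · have h1 := mul_meas_ge_le_lintegral₀ (hX n).ennreal_ofReal (ENNReal.ofReal (C / ε.toReal * r n))
    have h2 : μ {ω | C / ε.toReal * r n < X n ω} ≤
        μ {ω | ENNReal.ofReal (C / ε.toReal * r n) ≤ ENNReal.ofReal (X n ω)} :=
      measure_mono fun ω hω => ENNReal.ofReal_le_ofReal (le_of_lt hω)
    have h3 : ENNReal.ofReal (C / ε.toReal * r n) ≠ 0 := by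
      simpa using (by positivity : 0 < C / ε.toReal * r n)
    have h4 : ENNReal.ofReal (C * r n) = ENNReal.ofReal (C / ε.toReal * r n) * ε := by
      conv_rhs => rw [← ENNReal.ofReal_toReal hε', ← ENNReal.ofReal_mul (by positivity)]
      congr 1; rw [ENNReal.toReal_ofReal he.le]; field_simp
    have h5 := (mul_le_mul_right h2 _).trans (h1.trans (h n))
    rw [h4] at h5
    exact (ENNReal.mul_le_mul_iff_right h3 ENNReal.ofReal_ne_top).1 h5

/-- A bound on the expectation of `F (A, s)` for each fixed `s` carries over to a random `S` that
is independent of `A`. -/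
lemma lintegral_le_of_indepFun [IsProbabilityMeasure μ] {α β : Type*} [MeasurableSpace α]
    [MeasurableSpace β] [Countable β] [MeasurableSingletonClass β] {A : Ω → α} {S : Ω → β}
    (hA : Measurable A) (hS : Measurable S) (h : IndepFun A S μ) {F : α → β → ENNReal}
    (hF : ∀ s, Measurable fun a => F a s) {R : ENNReal} (hR : ∀ s, ∫⁻ ω, F (A ω) s ∂μ ≤ R) :
    ∫⁻ ω, F (A ω) (S ω) ∂μ ≤ R := by
  have hm : Measurable fun z : α × β => F z.1 z.2 := measurable_from_prod_countable_left hF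
  have : IsProbabilityMeasure (μ.map A) := Measure.isProbabilityMeasure_map hA.aemeasurable
  have : IsProbabilityMeasure (μ.map S) := Measure.isProbabilityMeasure_map hS.aemeasurable
  calc ∫⁻ ω, F (A ω) (S ω) ∂μ = ∫⁻ z, F z.1 z.2 ∂(μ.map fun ω => (A ω, S ω)) :=
        (lintegral_map hm (hA.prodMk hS)).symm
    _ = ∫⁻ z, F z.1 z.2 ∂((μ.map A).prod (μ.map S)) := by
        rw [(indepFun_iff_map_prod_eq_prod_map_map hA.aemeasurable hS.aemeasurable).1 h]
    _ = ∫⁻ s, ∫⁻ a, F a s ∂(μ.map A) ∂(μ.map S) := lintegral_prod_symm _ hm.aemeasurable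
    _ ≤ ∫⁻ _, R ∂(μ.map S) := lintegral_mono fun s => by
        rw [lintegral_map (hF s) hA]; exact hR s
    _ = R := by simp

end StochasticOrders

/-! ### Sampling without replacement -/

section Sampling

variable {α : Type*} [Fintype α] [DecidableEq α]

/-- The centred indicator of `e ∈ B`. -/
noncomputable def centeredIndicator (e : α) (B : Finset α) : ℝ :=
  (if e ∈ B then 1 else 0) - (B.card : ℝ) / Fintype.card α

lemma sum_centeredIndicator [Nonempty α] (B : Finset α) : ∑ e, centeredIndicator e B = 0 := by
  have : (Fintype.card α : ℝ) ≠ 0 := by exact_mod_cast Fintype.card_ne_zero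
  simp [centeredIndicator, mul_div_cancel₀ _ this]

lemma abs_centeredIndicator_le (e : α) (B : Finset α) : |centeredIndicator e B| ≤ 1 := by
  have h1 : (B.card : ℝ) / Fintype.card α ≤ 1 :=
    div_le_one_of_le₀ (by exact_mod_cast B.card_le_univ) (by positivity)
  have h0 : 0 ≤ (B.card : ℝ) / Fintype.card α := by positivity
  rw [centeredIndicator, abs_le]
  split_ifs <;> constructor <;> linarith

lemma centeredIndicator_map (σ : Equiv.Perm α) (e : α) (B : Finset α) :
    centeredIndicator (σ e) (B.map σ.toEmbedding) = centeredIndicator e B := by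
  simp [centeredIndicator]

variable {p : Finset α → ℝ}

/-- Relabelling the points preserves cardinalities, hence the weights `p`: the sampled set is
exchangeable. -/
lemma sum_centeredIndicator_perm (hp : ∀ B B' : Finset α, B.card = B'.card → p B = p B')
    (σ : Equiv.Perm α) (e e' : α) :
    ∑ B, p B * (centeredIndicator (σ e) B * centeredIndicator (σ e') B) =
      ∑ B, p B * (centeredIndicator e B * centeredIndicator e' B) := by
  rw [← Equiv.sum_comp σ.finsetCongr]
  refine Finset.sum_congr rfl fun B _ => ?_
  rw [Equiv.finsetCongr_apply, centeredIndicator_map, centeredIndicator_map,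
    hp (B.map σ.toEmbedding) B (B.card_map _)]

/-- Each row of the covariance matrix sums to zero, since the centred indicators do so for every
`B`. By exchangeability its off-diagonal entries coincide, so their absolute sum equals the modulus
of the diagonal entry, which is at most one. Centring by the actual size of `B` allows this size to
be random. -/
lemma sum_abs_centeredIndicator_le [Nonempty α] (hp0 : ∀ B, 0 ≤ p B) (hp1 : ∑ B, p B ≤ 1)
    (hp : ∀ B B' : Finset α, B.card = B'.card → p B = p B') (e : α) :
    ∑ e', |∑ B, p B * (centeredIndicator e B * centeredIndicator e' B)| ≤ 2 := by
  set u : α → ℝ := fun e' => ∑ B, p B * (centeredIndicator e B * centeredIndicator e' B) with hu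
  have hsum : ∑ e', u e' = 0 := by
    simp only [hu]
    rw [Finset.sum_comm]
    refine Finset.sum_eq_zero fun B _ => ?_
    rw [← Finset.mul_sum, ← Finset.mul_sum, sum_centeredIndicator, mul_zero, mul_zero]
  have hconst : ∀ a b, a ≠ e → b ≠ e → u a = u b := by
    intro a b ha hb
    have := sum_centeredIndicator_perm hp (Equiv.swap a b) e b
    rwa [Equiv.swap_apply_of_ne_of_ne ha.symm hb.symm, Equiv.swap_apply_right] at this
  have hdiag : |u e| ≤ 1 := by
    refine (Finset.abs_sum_le_sum_abs _ _).trans ((Finset.sum_le_sum fun B _ => ?_).trans hp1)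
    rw [abs_mul, abs_mul, abs_of_nonneg (hp0 B)]
    exact mul_le_of_le_one_right (hp0 B)
      (mul_le_one₀ (abs_centeredIndicator_le _ _) (abs_nonneg _) (abs_centeredIndicator_le _ _))
  have hoff : ∑ e' ∈ Finset.univ.erase e, |u e'| = |∑ e' ∈ Finset.univ.erase e, u e'| := by
    rcases (Finset.univ.erase e).eq_empty_or_nonempty with h | ⟨b, hb⟩
    · simp [h]
    · have h1 : ∀ a ∈ Finset.univ.erase e, u a = u b := fun a ha =>
        hconst a b (Finset.ne_of_mem_erase ha) (Finset.ne_of_mem_erase hb)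
      rw [Finset.sum_congr rfl h1, Finset.sum_congr rfl fun a ha => congrArg abs (h1 a ha)]
      simp [abs_mul]
  rw [← Finset.add_sum_erase _ _ (Finset.mem_univ e)] at hsum ⊢
  have : |∑ e' ∈ Finset.univ.erase e, u e'| = |u e| := by
    rw [← abs_neg]; congr 1; linarith
  rw [hoff, this]
  linarith

/-- The variance bound for a sum over a random set whose law depends only on the cardinality. -/
lemma sum_sq_sampling_le [Nonempty α] (hp0 : ∀ B, 0 ≤ p B) (hp1 : ∑ B, p B ≤ 1)
    (hp : ∀ B B' : Finset α, B.card = B'.card → p B = p B') (f : α → ℝ) :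
    ∑ B, p B * (∑ e, f e * centeredIndicator e B) ^ 2 ≤ 2 * ∑ e, f e ^ 2 := by
  set u : α → α → ℝ := fun e e' => ∑ B, p B * (centeredIndicator e B * centeredIndicator e' B)
    with hu
  have h1 : ∑ B, p B * (∑ e, f e * centeredIndicator e B) ^ 2 = ∑ e, ∑ e', f e * f e' * u e e' := by
    simp only [hu, Finset.mul_sum, sq, Finset.sum_mul]
    rw [Finset.sum_comm]
    refine Finset.sum_congr rfl fun e _ => ?_
    rw [Finset.sum_comm]
    exact Finset.sum_congr rfl fun e' _ => Finset.sum_congr rfl fun B _ => by ring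
  have hsymm : ∀ e e', u e e' = u e' e := fun e e' =>
    Finset.sum_congr rfl fun B _ => by ring
  -- Schur test: the quadratic form is bounded through the absolute row sums of the symmetric matrix
  -- `u`, which are at most 2.
  have h2 : ∀ e e', f e * f e' * u e e' ≤ f e ^ 2 / 2 * |u e e'| + f e' ^ 2 / 2 * |u e' e| := by
    intro e e'
    rw [hsymm e' e]
    have h3 : f e * f e' * u e e' ≤ |f e * f e'| * |u e e'| := by
      rw [← abs_mul]; exact le_abs_self _
    have h4 : |f e * f e'| ≤ f e ^ 2 / 2 + f e' ^ 2 / 2 := by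
      rw [abs_le]; constructor <;> nlinarith [sq_nonneg (f e - f e'), sq_nonneg (f e + f e')]
    nlinarith [abs_nonneg (u e e')]
  have h5 : ∀ e, ∑ e', f e ^ 2 / 2 * |u e e'| ≤ f e ^ 2 := fun e => by
    rw [← Finset.mul_sum]
    have := sum_abs_centeredIndicator_le hp0 hp1 hp e
    nlinarith [sq_nonneg (f e)]
  rw [h1]
  calc ∑ e, ∑ e', f e * f e' * u e e'
      ≤ ∑ e, ∑ e', (f e ^ 2 / 2 * |u e e'| + f e' ^ 2 / 2 * |u e' e|) :=
        Finset.sum_le_sum fun e _ => Finset.sum_le_sum fun e' _ => h2 e e'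
    _ = ∑ e, ∑ e', f e ^ 2 / 2 * |u e e'| + ∑ e', ∑ e, f e' ^ 2 / 2 * |u e' e| := by
        simp only [Finset.sum_add_distrib]
        congr 1
        exact Finset.sum_comm
    _ ≤ ∑ e, f e ^ 2 + ∑ e, f e ^ 2 :=
        add_le_add (Finset.sum_le_sum fun e _ => h5 e) (Finset.sum_le_sum fun e _ => h5 e)
    _ = 2 * ∑ e, f e ^ 2 := by ring

end Sampling

/-! ### Edge probabilities -/

section Network

variable {N T : ℕ}

lemma LatentParams.edgeProb_nonneg {d : Fin T → ℕ} (θ : LatentParams N T d) (t : Fin T)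
    (i j : Fin N) : 0 ≤ θ.edgeProb t i j := by
  rw [edgeProb]; split_ifs
  · rfl
  · exact Real.sigmoid_nonneg _

lemma LatentParams.edgeProb_le_one {d : Fin T → ℕ} (θ : LatentParams N T d) (t : Fin T)
    (i j : Fin N) : θ.edgeProb t i j ≤ 1 := by
  rw [edgeProb]; split_ifs
  · exact zero_le_one
  · exact Real.sigmoid_le_one _

lemma LatentParams.edgeProb_diag {d : Fin T → ℕ} (θ : LatentParams N T d) (t : Fin T)
    (i : Fin N) : θ.edgeProb t i i = 0 := by
  simp [edgeProb]

lemma LatentParams.edgeProb_symm {d : Fin T → ℕ} (θ : LatentParams N T d) (t : Fin T)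
    (i j : Fin N) : θ.edgeProb t i j = θ.edgeProb t j i := by
  have : θ.theta t i j = θ.theta t j i := by
    simp only [theta, add_comm (θ.α i), mul_comm (θ.Z t i _)]
  simp only [edgeProb, this, eq_comm]

/-- `P` is a symmetric array of probabilities with zero diagonal. -/
structure IsEdgeProb (P : Layers N T) : Prop where
  nonneg : ∀ t i j, 0 ≤ P t i j
  le_one : ∀ t i j, P t i j ≤ 1
  symm : ∀ t i j, P t i j = P t j i
  diag : ∀ t i, P t i i = 0

lemma LatentParams.isEdgeProb {d : Fin T → ℕ} (θ : LatentParams N T d) : IsEdgeProb θ.edgeProb :=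
  ⟨θ.edgeProb_nonneg, θ.edgeProb_le_one, θ.edgeProb_symm, θ.edgeProb_diag⟩

/-! ### Moments of the noise -/

/-- The noise entries at `(i, j)` and `(j, i)` are the same variable, so a linear form is folded
onto `i < j` before independence is used. The coefficients `x` need not be symmetric. -/
lemma sum_eq_sum_lt (f x : Fin N → Fin N → ℝ) (hs : ∀ i j, f i j = f j i) (hd : ∀ i, f i i = 0) :
    ∑ e : Fin N × Fin N, f e.1 e.2 * x e.1 e.2 =
      ∑ e : {e : Fin N × Fin N // e.1 < e.2}, f e.1.1 e.1.2 * (x e.1.1 e.1.2 + x e.1.2 e.1.1) := by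
  have h1 : ∀ e : Fin N × Fin N, f e.1 e.2 * x e.1 e.2 =
      (if e.1 < e.2 then f e.1 e.2 * x e.1 e.2 else 0) +
        (if e.2 < e.1 then f e.1 e.2 * x e.1 e.2 else 0) := by
    rintro ⟨i, j⟩
    rcases lt_trichotomy i j with h | rfl | h
    · simp [h, h.not_gt]
    · simp [hd]
    · simp [h, h.not_gt]
  have h2 : ∑ e : Fin N × Fin N, (if e.2 < e.1 then f e.1 e.2 * x e.1 e.2 else 0) =
      ∑ e : Fin N × Fin N, (if e.1 < e.2 then f e.1 e.2 * x e.2 e.1 else 0) := by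
    rw [← Equiv.sum_comp (Equiv.prodComm (Fin N) (Fin N))]
    refine Finset.sum_congr rfl fun e _ => ?_
    simp only [Equiv.prodComm_apply, Prod.fst_swap, Prod.snd_swap, hs e.2 e.1]
  rw [Finset.sum_congr rfl fun e _ => h1 e, Finset.sum_add_distrib, h2, ← Finset.sum_add_distrib]
  rw [← Finset.sum_subtype (Finset.univ.filter fun e : Fin N × Fin N => e.1 < e.2)
    (fun e => by simp) fun e => f e.1 e.2 * (x e.1 e.2 + x e.2 e.1), Finset.sum_filter]
  refine Finset.sum_congr rfl fun e _ => ?_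
  split_ifs <;> ring

variable {Ω : Type*} [MeasurableSpace Ω] {μ : Measure Ω}
  {A : Ω → Layers N T} {P : Layers N T}

lemma IsBernoulliNetwork.measurable_apply (hA : IsBernoulliNetwork μ A P) (t : Fin T)
    (i j : Fin N) : Measurable fun ω => A ω t i j :=
  (measurable_pi_apply j).comp ((measurable_pi_apply i).comp
    ((measurable_pi_apply t).comp hA.measurable))

lemma IsBernoulliNetwork.abs_sub_le (hA : IsBernoulliNetwork μ A P) (hP : IsEdgeProb P) (ω : Ω)
    (t : Fin T) (i j : Fin N) : |A ω t i j - P t i j| ≤ 1 := by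
  have h0 := hP.nonneg t i j
  have h1 := hP.le_one t i j
  rw [abs_le]
  rcases hA.binary ω t i j with h | h <;> rw [h] <;> constructor <;> linarith

lemma IsBernoulliNetwork.integral_eq (hA : IsBernoulliNetwork μ A P) (hP : IsEdgeProb P)
    (t : Fin T) (i j : Fin N) : ∫ ω, A ω t i j ∂μ = P t i j := by
  have key : ∀ i j, i < j → ∫ ω, A ω t i j ∂μ = P t i j := by
    intro i j hij
    have h1 : (fun ω => A ω t i j) = Set.indicator {ω | A ω t i j = 1} 1 := by
      funext ω
      rcases hA.binary ω t i j with h | h <;> simp [Set.indicator, h]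
    rw [h1]
    refine (integral_indicator_one (hA.measurable_apply t i j (measurableSet_singleton 1))).trans ?_
    change (μ {ω | A ω t i j = 1}).toReal = _
    rw [hA.bernoulli t i j hij, ENNReal.toReal_ofReal (hP.nonneg t i j)]
  rcases lt_trichotomy i j with h | rfl | h
  · exact key i j h
  · simp [hA.diag, hP.diag]
  · rw [hP.symm, ← key j i h]
    exact integral_congr_ae (.of_forall fun ω => hA.symm ω t i j)

variable [IsProbabilityMeasure μ]

lemma IsBernoulliNetwork.integrable (hA : IsBernoulliNetwork μ A P) (t : Fin T) (i j : Fin N) :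
    Integrable (fun ω => A ω t i j) μ :=
  .of_bound (hA.measurable_apply t i j).aestronglyMeasurable 1 <| .of_forall fun ω => by
    rcases hA.binary ω t i j with h | h <;> simp [h]

lemma IsBernoulliNetwork.integral_sq_sub_le (hA : IsBernoulliNetwork μ A P) (hP : IsEdgeProb P)
    (t : Fin T) (i j : Fin N) : ∫ ω, (A ω t i j - P t i j) ^ 2 ∂μ ≤ P t i j := by
  have h1 : ∀ ω, (A ω t i j - P t i j) ^ 2 = (1 - 2 * P t i j) * A ω t i j + P t i j ^ 2 := by
    intro ω
    rcases hA.binary ω t i j with h | h <;> rw [h] <;> ring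
  simp_rw [h1]
  rw [integral_add ((hA.integrable t i j).const_mul _) (integrable_const _), integral_const_mul,
    hA.integral_eq hP, integral_const, probReal_univ, one_smul]
  nlinarith [sq_nonneg (P t i j)]

/-- The noise stays in the closed unit ball of the sup norm, a compact set on which a continuous
function is bounded. -/
lemma IsBernoulliNetwork.integrable_of_continuous (hA : IsBernoulliNetwork μ A P)
    (hP : IsEdgeProb P) {F : Layers N T → ℝ} (hF : Continuous F) :
    Integrable (fun ω => F (A ω - P)) μ := by
  obtain ⟨C, hC⟩ := (isCompact_closedBall (0 : Layers N T) 1).exists_bound_of_continuousOn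
    hF.continuousOn
  refine .of_bound (hF.measurable.comp (hA.measurable.sub_const P)).aestronglyMeasurable C
    (.of_forall fun ω => hC _ ?_)
  rw [mem_closedBall_zero_iff, pi_norm_le_iff_of_nonneg zero_le_one]
  intro t
  rw [pi_norm_le_iff_of_nonneg zero_le_one]
  intro i
  rw [pi_norm_le_iff_of_nonneg zero_le_one]
  exact fun j => hA.abs_sub_le hP ω t i j

lemma IsBernoulliNetwork.integral_sqDist_le (hA : IsBernoulliNetwork μ A P) (hP : IsEdgeProb P)
    {b : ℝ} (hb : ∀ t i j, P t i j ≤ b) :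
    ∫ ω, sqDist Finset.univ (A ω) P ∂μ ≤ T * ((N : ℝ) ^ 2 * b) := by
  have hi : ∀ t (e : Fin N × Fin N), Integrable (fun ω => (A ω t e.1 e.2 - P t e.1 e.2) ^ 2) μ :=
    fun t e => hA.integrable_of_continuous hP (F := fun X => X t e.1 e.2 ^ 2) (by fun_prop)
  simp only [sqDist]
  rw [integral_finsetSum _ fun t _ => integrable_finsetSum _ fun e _ => hi t e]
  have : ∀ t, ∫ ω, ∑ e : Fin N × Fin N, (A ω t e.1 e.2 - P t e.1 e.2) ^ 2 ∂μ ≤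
      (N : ℝ) ^ 2 * b := by
    intro t
    rw [integral_finsetSum _ fun e _ => hi t e]
    refine (Finset.sum_le_sum fun e _ =>
      (hA.integral_sq_sub_le hP t e.1 e.2).trans (hb t e.1 e.2)).trans ?_
    simp [sq]
  refine (Finset.sum_le_sum fun t _ => this t).trans ?_
  simp

/-- The second moment of a linear form in the noise of one layer. -/
lemma IsBernoulliNetwork.integral_layer_sq_le (hA : IsBernoulliNetwork μ A P) (hP : IsEdgeProb P)
    (t : Fin T) {x : Fin N → Fin N → ℝ} {B : ℝ} (hx : ∀ i j, |x i j| ≤ B) :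
    ∫ ω, (∑ e : Fin N × Fin N, (A ω t e.1 e.2 - P t e.1 e.2) * x e.1 e.2) ^ 2 ∂μ ≤
      4 * B ^ 2 * (N : ℝ) ^ 2 := by
  let ι := {e : Fin N × Fin N // e.1 < e.2}
  let c : ι → ℝ := fun e => x e.1.1 e.1.2 + x e.1.2 e.1.1
  let Y : ι → Ω → ℝ := fun e ω => (A ω t e.1.1 e.1.2 - P t e.1.1 e.1.2) * c e
  have hc : ∀ e, c e ^ 2 ≤ 4 * B ^ 2 := fun e => by
    have h1 := abs_le.1 (hx e.1.1 e.1.2)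
    have h2 := abs_le.1 (hx e.1.2 e.1.1)
    have h3 : |c e| ≤ 2 * B := abs_le.2 ⟨by simp only [c]; linarith, by simp only [c]; linarith⟩
    have := sq_le_sq' (by linarith [(abs_le.1 h3).1]) (abs_le.1 h3).2
    linarith
  have hYm : ∀ e, Measurable (Y e) := fun e =>
    ((hA.measurable_apply t _ _).sub_const _).mul_const _
  have hYL : ∀ e, MemLp (Y e) 2 μ := fun e =>
    MemLp.of_bound (hYm e).aestronglyMeasurable |c e| <| .of_forall fun ω => by
      rw [Real.norm_eq_abs, abs_mul]
      exact mul_le_of_le_one_left (abs_nonneg _) (hA.abs_sub_le hP ω t _ _)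
  have hY0 : ∀ e, ∫ ω, Y e ω ∂μ = 0 := fun e => by
    simp only [Y]
    rw [integral_mul_const, integral_sub (hA.integrable t _ _) (integrable_const _),
      hA.integral_eq hP]
    simp
  have hYi : iIndepFun Y μ :=
    (hA.indep t).comp (fun e a => (a - P t e.1.1 e.1.2) * c e) fun e => by fun_prop
  have hY2 : ∀ e, variance (Y e) μ ≤ 4 * B ^ 2 := fun e => by
    refine (variance_le_expectation_sq (hYm e).aestronglyMeasurable).trans ?_
    have : ∀ ω, (Y e ^ 2) ω ≤ 4 * B ^ 2 := fun ω => by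
      simp only [Pi.pow_apply, Y]
      rw [mul_pow]
      have := hA.abs_sub_le hP ω t e.1.1 e.1.2
      exact (mul_le_of_le_one_left (sq_nonneg _) ((sq_le_one_iff_abs_le_one _).2 this)).trans (hc e)
    calc ∫ ω, (Y e ^ 2) ω ∂μ ≤ ∫ _, 4 * B ^ 2 ∂μ :=
          integral_mono (hYL e).integrable_sq (integrable_const _) this
      _ = 4 * B ^ 2 := by simp
  -- Variances add over unordered pairs. Each is at most `4 * B ^ 2` because two coefficients were
  -- merged, and there are at most `N ^ 2` pairs.
  have hvar := IndepFun.variance_sum (s := Finset.univ) (μ := μ) (X := Y) (fun e _ => hYL e)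
    fun e _ e' _ h => hYi.indepFun h
  have hsum0 : ∫ ω, (∑ e, Y e) ω ∂μ = 0 := by
    simp only [Finset.sum_apply]
    rw [integral_finsetSum _ fun e _ => (hYL e).integrable one_le_two]
    simp [hY0]
  rw [variance_of_integral_eq_zero (Finset.aemeasurable_sum _ fun e _ => (hYm e).aemeasurable)
    hsum0] at hvar
  have hlhs : ∀ ω, ∑ e : Fin N × Fin N, (A ω t e.1 e.2 - P t e.1 e.2) * x e.1 e.2 =
      (∑ e, Y e) ω := fun ω => by
    rw [Finset.sum_apply]
    exact sum_eq_sum_lt (fun i j => A ω t i j - P t i j) x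
      (fun i j => by rw [hA.symm ω t i j, hP.symm t i j])
      (fun i => by rw [hA.diag, hP.diag, sub_zero])
  simp_rw [hlhs]
  rw [hvar]
  refine (Finset.sum_le_sum fun e _ => hY2 e).trans ?_
  rw [Finset.sum_const, nsmul_eq_mul, mul_comm]
  have : ((Finset.univ : Finset ι).card : ℝ) ≤ (N : ℝ) ^ 2 := by
    have h := Fintype.card_subtype_le fun e : Fin N × Fin N => e.1 < e.2
    simp only [Fintype.card_prod, Fintype.card_fin] at h
    rw [Finset.card_univ, sq]
    exact_mod_cast h
  exact mul_le_mul_of_nonneg_left this (by positivity)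

lemma continuous_innerOn (E : Finset (Fin N × Fin N)) (X : Layers N T) :
    Continuous fun R : Layers N T => innerOn E R X := by
  unfold innerOn; fun_prop

/-- The second moments of finitely many linear forms in the noise, without any assumption on the
joint distribution of the layers. -/
lemma IsBernoulliNetwork.integral_sum_innerOn_sq_le (hA : IsBernoulliNetwork μ A P)
    (hP : IsEdgeProb P) (E : Finset (Fin N × Fin N)) {M : ℕ} {X : Fin M → Layers N T} {B : ℝ}
    (hX : ∀ m t i j, |X m t i j| ≤ B) :
    ∫ ω, ∑ m, innerOn E (A ω - P) (X m) ^ 2 ∂μ ≤ 4 * B ^ 2 * (M * T ^ 2 * N ^ 2) := by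
  have hform : ∀ m ω, innerOn E (A ω - P) (X m) ^ 2 ≤ T * ∑ t,
      (∑ e : Fin N × Fin N, (A ω t e.1 e.2 - P t e.1 e.2) *
        (if (e.1, e.2) ∈ E then X m t e.1 e.2 else 0)) ^ 2 := by
    intro m ω
    have h1 : innerOn E (A ω - P) (X m) = ∑ t, ∑ e : Fin N × Fin N,
        (A ω t e.1 e.2 - P t e.1 e.2) * (if (e.1, e.2) ∈ E then X m t e.1 e.2 else 0) := by
      simp only [innerOn, Pi.sub_apply, mul_ite, mul_zero]
      refine Finset.sum_congr rfl fun t _ => ?_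
      rw [← Finset.sum_filter]
      simp
    rw [h1]
    simpa using sq_sum_le_card_mul_sum_sq (s := (Finset.univ : Finset (Fin T)))
      (f := fun t => ∑ e : Fin N × Fin N, (A ω t e.1 e.2 - P t e.1 e.2) *
        (if (e.1, e.2) ∈ E then X m t e.1 e.2 else 0))
  have hi : ∀ m t, Integrable (fun ω => (∑ e : Fin N × Fin N, (A ω t e.1 e.2 - P t e.1 e.2) *
      (if (e.1, e.2) ∈ E then X m t e.1 e.2 else 0)) ^ 2) μ := fun m t =>
    hA.integrable_of_continuous hP (F := fun R => (∑ e : Fin N × Fin N, R t e.1 e.2 *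
      (if (e.1, e.2) ∈ E then X m t e.1 e.2 else 0)) ^ 2) (by fun_prop)
  have hm : ∀ m, ∫ ω, innerOn E (A ω - P) (X m) ^ 2 ∂μ ≤
      T * (T * (4 * B ^ 2 * (N : ℝ) ^ 2)) := by
    intro m
    refine (integral_mono (hA.integrable_of_continuous hP
      (F := fun R => innerOn E R (X m) ^ 2) ((continuous_innerOn E (X m)).pow 2))
      ((integrable_finsetSum _ fun t _ => hi m t).const_mul _) (hform m)).trans ?_
    rw [integral_const_mul, integral_finsetSum _ fun t _ => hi m t]
    refine mul_le_mul_of_nonneg_left ((Finset.sum_le_sum fun t _ =>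
      hA.integral_layer_sq_le hP t (B := B)
        (x := fun i j => if (i, j) ∈ E then X m t i j else 0) fun i j => ?_).trans
        (by simp)) (by positivity)
    split_ifs
    · exact hX m t i j
    · simpa using (abs_nonneg _).trans (hX m t i j)
  rw [integral_finsetSum _ fun m _ => hA.integrable_of_continuous hP
      (F := fun R => innerOn E R (X m) ^ 2) ((continuous_innerOn E (X m)).pow 2)]
  refine (Finset.sum_le_sum fun m _ => hm m).trans (le_of_eq ?_)
  simp only [Finset.sum_const, Finset.card_univ, Fintype.card_fin, nsmul_eq_mul]
  ring

end Network

/-! ### Random splits -/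

section Split

variable {N K T M : ℕ}

instance : Finite (EdgeSplit N K) :=
  Finite.of_injective (fun s => (s.train, s.group)) fun s s' h => by
    cases s; cases s'; simpa using h

instance : DiscreteMeasurableSpace (EdgeSplit N K) := ⟨fun _ => trivial⟩

/-- The sum of a product of two arrays over the layers and over the ordered pairs that represent
an unordered pair. -/
noncomputable def pairInner (X Y : Layers N T) (e : Sym2 (Fin N)) : ℝ :=
  ∑ t, ∑ z ∈ Finset.univ.filter (fun z : Fin N × Fin N => s(z.1, z.2) = e),
    X t z.1 z.2 * Y t z.1 z.2

lemma sum_pairInner (B : Finset (Sym2 (Fin N))) (X Y : Layers N T) :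
    ∑ e ∈ B, pairInner X Y e =
      innerOn (Finset.univ.filter fun z : Fin N × Fin N => s(z.1, z.2) ∈ B) X Y := by
  simp only [pairInner, innerOn]
  rw [Finset.sum_comm]
  refine Finset.sum_congr rfl fun t _ => ?_
  simp only [Finset.sum_filter]
  rw [Finset.sum_comm]
  exact Finset.sum_congr rfl fun z _ => by simp

lemma card_filter_sym2_le (B : Finset (Sym2 (Fin N))) :
    (Finset.univ.filter fun z : Fin N × Fin N => s(z.1, z.2) ∈ B).card ≤ 2 * B.card := by
  refine Finset.card_le_mul_card_image_of_maps_to (t := B) (f := fun z : Fin N × Fin N => s(z.1, z.2))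
    (fun z hz => (Finset.mem_filter.1 hz).2) 2 fun e _ => ?_
  induction e with | _ i j
  refine (Finset.card_le_card (t := {(i, j), (j, i)}) fun z hz => ?_).trans Finset.card_le_two
  have := (Finset.mem_filter.1 hz).2
  rw [Sym2.eq_iff] at this
  simp only [Finset.mem_insert, Finset.mem_singleton, Prod.ext_iff]
  exact this

lemma abs_pairInner_le {X Y : Layers N T} {B : ℝ} (hX : ∀ t i j, |X t i j| ≤ B)
    (hY : ∀ t i j, |Y t i j| ≤ B) (e : Sym2 (Fin N)) : |pairInner X Y e| ≤ 2 * T * B ^ 2 := by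
  have hcard := card_filter_sym2_le (N := N) {e}
  simp only [Finset.mem_singleton, Finset.card_singleton] at hcard
  have hcard' : ((Finset.univ.filter fun z : Fin N × Fin N => s(z.1, z.2) = e).card : ℝ) ≤ 2 := by
    exact_mod_cast hcard
  have h1 : ∀ t, |∑ z ∈ Finset.univ.filter (fun z : Fin N × Fin N => s(z.1, z.2) = e),
      X t z.1 z.2 * Y t z.1 z.2| ≤ 2 * B ^ 2 := fun t => by
    refine (Finset.abs_sum_le_sum_abs _ _).trans ((Finset.sum_le_card_nsmul _ _ (B ^ 2)
      fun z _ => ?_).trans ?_)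
    · rw [abs_mul, sq]
      exact mul_le_mul (hX _ _ _) (hY _ _ _) (abs_nonneg _) ((abs_nonneg _).trans (hX t z.1 z.2))
    · rw [nsmul_eq_mul]
      exact mul_le_mul_of_nonneg_right hcard' (sq_nonneg _)
  refine (Finset.abs_sum_le_sum_abs _ _).trans ((Finset.sum_le_sum fun t _ => h1 t).trans ?_)
  simp; linarith

/-- The sampling fraction of the unordered pairs. -/
noncomputable def EdgeSplit.rate (s : EdgeSplit N K) : ℝ :=
  (s.train.card : ℝ) / Fintype.card (Sym2 (Fin N))

/-- The deviation of an inner product over `Ψ₁` from its conditional expectation. -/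
noncomputable def EdgeSplit.deviation (s : EdgeSplit N K) (X Y : Layers N T) : ℝ :=
  innerOn s.psi1 X Y - s.rate * innerOn Finset.univ X Y

/-- Sampling acts on unordered pairs, so the ordered entries are first grouped by the unordered pair
they represent. -/
lemma EdgeSplit.deviation_eq (s : EdgeSplit N K) (X Y : Layers N T) :
    s.deviation X Y = ∑ e, pairInner X Y e * centeredIndicator e s.train := by
  have h1 := sum_pairInner s.train X Y
  have h2 := sum_pairInner Finset.univ X Y
  simp only [Finset.mem_univ, Finset.filter_true] at h2
  rw [EdgeSplit.deviation, ← h2, EdgeSplit.psi1, ← h1, EdgeSplit.rate]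
  simp only [centeredIndicator, mul_sub, Finset.sum_sub_distrib, mul_ite, mul_one, mul_zero,
    Finset.sum_ite_mem, Finset.univ_inter]
  rw [← Finset.sum_mul, mul_comm]

lemma innerOn_psi2 (s : EdgeSplit N K) (X Y : Layers N T) :
    innerOn s.psi2 X Y = innerOn Finset.univ X Y - innerOn s.psi1 X Y := by
  simp only [innerOn, EdgeSplit.psi2, ← Finset.sum_sub_distrib]
  refine Finset.sum_congr rfl fun t _ => ?_
  rw [eq_sub_iff_add_eq, Finset.sum_sdiff (Finset.subset_univ _)]

/-- The total over all pairs is the `Ψ₁` part minus the deviation, divided by the rate; subtracting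
the `Ψ₁` part leaves `Ψ₂`. -/
lemma innerOn_psi2_sub {s : EdgeSplit N K} (hs : s.rate ≠ 0) (X Y : Layers N T) :
    innerOn s.psi2 X Y - (1 - s.rate) / s.rate * innerOn s.psi1 X Y =
      -(1 / s.rate) * s.deviation X Y := by
  rw [innerOn_psi2, EdgeSplit.deviation]
  field_simp
  ring

lemma card_sym2_le_sq (hN : 1 ≤ N) : (Fintype.card (Sym2 (Fin N)) : ℝ) ≤ (N : ℝ) ^ 2 := by
  have h : Fintype.card (Sym2 (Fin N)) ≤ N ^ 2 := by
    rw [Sym2.card, Fintype.card_fin, Nat.choose_two_right, Nat.add_sub_cancel]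
    exact Nat.div_le_of_le_mul (by nlinarith)
  exact_mod_cast h

/-- The fraction counts ordered pairs and the rate unordered ones. An unordered pair has at most two
representatives, and there are at most `N ^ 2` unordered pairs, hence the factor 2. -/
lemma EdgeSplit.rate_bounds (hN : 1 ≤ N) (s : EdgeSplit N K) {c : ℝ}
    (h1 : c ≤ s.fraction) (h2 : s.fraction ≤ 1 - c) :
    c / 2 ≤ s.rate ∧ c / 2 ≤ 1 - s.rate := by
  have : Nonempty (Sym2 (Fin N)) := ⟨s(⟨0, hN⟩, ⟨0, hN⟩)⟩
  have hN' : (1 : ℝ) ≤ N := by exact_mod_cast hN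
  have hN0 : (0 : ℝ) < (N : ℝ) ^ 2 := by positivity
  have hn0 : (0 : ℝ) < Fintype.card (Sym2 (Fin N)) := by exact_mod_cast Fintype.card_pos
  have hn := card_sym2_le_sq hN
  have e1 : (s.psi1.card : ℝ) ≤ 2 * s.train.card := by
    exact_mod_cast card_filter_sym2_le s.train
  have e2 : (s.psi2.card : ℝ) ≤ 2 * (s.trainᶜ).card := by
    have h := card_filter_sym2_le s.trainᶜ
    have : s.psi2 = Finset.univ.filter fun z : Fin N × Fin N => s(z.1, z.2) ∈ s.trainᶜ := by
      ext z; simp [EdgeSplit.psi2, EdgeSplit.psi1]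
    rw [this]; exact_mod_cast h
  have e3 : (s.psi2.card : ℝ) = (N : ℝ) ^ 2 - s.psi1.card := by
    rw [EdgeSplit.psi2, ← Finset.compl_eq_univ_sdiff, Finset.card_compl,
      Nat.cast_sub (Finset.card_le_univ _)]
    simp [sq]
  have e4 : ((s.trainᶜ).card : ℝ) = Fintype.card (Sym2 (Fin N)) - s.train.card := by
    rw [Finset.card_compl, Nat.cast_sub (Finset.card_le_univ _)]
  rw [EdgeSplit.fraction, le_div_iff₀ hN0] at h1
  rw [EdgeSplit.fraction, div_le_iff₀ hN0] at h2
  have hrate : s.rate * Fintype.card (Sym2 (Fin N)) = s.train.card := by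
    rw [EdgeSplit.rate, div_mul_cancel₀ _ hn0.ne']
  rcases le_or_gt c 0 with hc | hc
  · have r0 : 0 ≤ s.rate := by rw [EdgeSplit.rate]; positivity
    have r1 : s.rate ≤ 1 := div_le_one_of_le₀ (by exact_mod_cast s.train.card_le_univ) hn0.le
    constructor <;> linarith
  · constructor
    · rw [EdgeSplit.rate, le_div_iff₀ hn0]
      nlinarith
    · have : c / 2 * Fintype.card (Sym2 (Fin N)) ≤
          (1 - s.rate) * Fintype.card (Sym2 (Fin N)) := by
        rw [sub_mul, hrate]
        nlinarith
      exact le_of_mul_le_mul_right this hn0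

/-- The second moments of the deviations of finitely many inner products of bounded arrays. -/
lemma IsUniformSplit.integral_deviation_sq_le {Ω : Type*} [MeasurableSpace Ω] {μ : Measure Ω}
    [IsProbabilityMeasure μ] {S : Ω → EdgeSplit N K} (hS : Measurable S)
    (hU : IsUniformSplit μ S) (hN : 1 ≤ N) {X : Fin M → Layers N T} {B : ℝ}
    (hX : ∀ m t i j, |X m t i j| ≤ B) :
    ∫ ω, ∑ m, ∑ m', (S ω).deviation (X m) (X m') ^ 2 ∂μ ≤
      8 * B ^ 4 * ((N : ℝ) * M * T) ^ 2 := by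
  have : Nonempty (Sym2 (Fin N)) := ⟨s(⟨0, hN⟩, ⟨0, hN⟩)⟩
  let _ : MeasurableSpace (Finset (Sym2 (Fin N))) := ⊤
  have : DiscreteMeasurableSpace (Finset (Sym2 (Fin N))) := ⟨fun _ => trivial⟩
  have hT : Measurable fun ω => (S ω).train := (Measurable.of_discrete (f := EdgeSplit.train)).comp hS
  set p : Finset (Sym2 (Fin N)) → ℝ := fun B => μ.real {ω | (S ω).train = B} with hp
  have hpmap : ∀ B, (μ.map fun ω => (S ω).train).real {B} = p B := fun B => by
    rw [measureReal_def, Measure.map_apply hT (measurableSet_singleton B)]; rfl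
  have hprob : IsProbabilityMeasure (μ.map fun ω => (S ω).train) :=
    Measure.isProbabilityMeasure_map hT.aemeasurable
  have hp1 : ∑ B, p B ≤ 1 := by
    simp only [← hpmap]
    rw [sum_measureReal_singleton]
    exact measureReal_le_one
  have hpc : ∀ B B' : Finset (Sym2 (Fin N)), B.card = B'.card → p B = p B' := fun B B' h => by
    simp only [hp, measureReal_def, hU B B' h]
  have hint : ∀ g : Finset (Sym2 (Fin N)) → ℝ, ∫ ω, g (S ω).train ∂μ = ∑ B, p B * g B := by
    intro g
    have h1 := integral_map (μ := μ) hT.aemeasurable (f := g)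
      (Measurable.of_discrete).aestronglyMeasurable
    rw [← h1, integral_fintype .of_finite]
    simp [hpmap]
  have hterm : ∀ m m', ∑ B, p B * (∑ e, pairInner (X m) (X m') e * centeredIndicator e B) ^ 2 ≤
      8 * B ^ 4 * ((N : ℝ) * T) ^ 2 := fun m m' => by
    refine (sum_sq_sampling_le (fun B => measureReal_nonneg) hp1 hpc _).trans ?_
    have h1 : ∀ e, pairInner (X m) (X m') e ^ 2 ≤ (2 * T * B ^ 2) ^ 2 := fun e =>
      sq_le_sq' (by linarith [(abs_le.1 (abs_pairInner_le (hX m) (hX m') e)).1])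
        (abs_le.1 (abs_pairInner_le (hX m) (hX m') e)).2
    have h2 := Finset.sum_le_card_nsmul Finset.univ _ _ fun e _ => h1 e
    rw [nsmul_eq_mul, Finset.card_univ] at h2
    have h3 := mul_le_mul_of_nonneg_right (card_sym2_le_sq hN) (sq_nonneg (2 * (T : ℝ) * B ^ 2))
    calc _ ≤ 2 * ((N : ℝ) ^ 2 * (2 * T * B ^ 2) ^ 2) := by linarith
      _ = _ := by ring
  simp only [EdgeSplit.deviation_eq]
  rw [hint fun D => ∑ m, ∑ m', (∑ e, pairInner (X m) (X m') e * centeredIndicator e D) ^ 2]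
  simp only [Finset.mul_sum]
  rw [Finset.sum_comm]
  have : ∀ m, ∑ B, ∑ m', p B * (∑ e, pairInner (X m) (X m') e * centeredIndicator e B) ^ 2 ≤
      M * (8 * B ^ 4 * ((N : ℝ) * T) ^ 2) := fun m => by
    rw [Finset.sum_comm]
    refine (Finset.sum_le_sum fun m' _ => hterm m m').trans (by simp)
  refine (Finset.sum_le_sum fun m _ => this m).trans (le_of_eq ?_)
  simp only [Finset.sum_const, Finset.card_univ, Fintype.card_fin, nsmul_eq_mul]
  ring

end Split

/-! ### The two losses for a fixed realization -/

section Realization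

variable {N M T K : ℕ}

lemma le_iSup_fin {f : Fin M → ℝ} {c : ℝ} (h : ⨆ m, f m ≤ c) (m : Fin M) : f m ≤ c :=
  (le_ciSup (Set.finite_range f).bddAbove m).trans h

lemma abs_le_of_sqrt_sum_le {ι : Type*} [Fintype ι] {f : ι → ℝ} {c : ℝ}
    (h : √(∑ i, f i ^ 2) ≤ c) (i : ι) : |f i| ≤ c := by
  rw [← Real.sqrt_sq_eq_abs]
  exact (Real.sqrt_le_sqrt (Finset.single_le_sum (f := fun i => f i ^ 2)
    (fun i _ => sq_nonneg (f i)) (Finset.mem_univ i))).trans h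

lemma xiStar_nonneg (s : EdgeSplit N K) (Pstar : Fin M → Layers N T) (P : Layers N T) :
    0 ≤ xiStar s Pstar P :=
  Real.iInf_nonneg fun _ => sqDist_nonneg _ _ _

lemma xiStar_le (s : EdgeSplit N K) (Pstar : Fin M → Layers N T) (P : Layers N T)
    {w : Fin M → ℝ} (hw : w ∈ stdSimplex ℝ (Fin M)) :
    xiStar s Pstar P ≤ sqDist s.psi1 (average w Pstar) P :=
  infW_le (f := limitLoss s Pstar P) (fun _ => sqDist_nonneg _ _ _) hw

/-- Here `x`, `y` stand for actual losses and `g`, `h` for comparison losses. The squares allow for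
two successive approximations, as needed on `Ψ₂`; the constant 32 is generous. -/
lemma le_mul_of_close {ε x g h y : ℝ} (h0 : 0 < ε) (hε : ε ≤ 1 / 32) (hh : 0 ≤ h)
    (hx : x ≤ (1 + ε) ^ 2 * g) (hgh : (1 - 2 * ε) * g ≤ (1 + 2 * ε) * h)
    (hy : (1 - ε) ^ 2 * h ≤ y) : x ≤ (1 + 32 * ε) * y := by
  have h1 : 0 < 1 - 2 * ε := by linarith
  refine le_of_mul_le_mul_left ?_ h1
  have hp : (1 + ε) ^ 2 * (1 + 2 * ε) ≤ (1 + 32 * ε) * ((1 - 2 * ε) * (1 - ε) ^ 2) := by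
    have a1 : (1 + ε) ^ 2 * (1 + 2 * ε) ≤ 1 + 5 * ε := by nlinarith [mul_pos h0 h0]
    have a2 : 1 - 4 * ε ≤ (1 - 2 * ε) * (1 - ε) ^ 2 := by nlinarith [mul_pos h0 h0]
    have a3 : 1 + 5 * ε ≤ (1 + 32 * ε) * (1 - 4 * ε) := by nlinarith
    exact a1.trans (a3.trans (mul_le_mul_of_nonneg_left a2 (by linarith)))
  calc (1 - 2 * ε) * x ≤ (1 - 2 * ε) * ((1 + ε) ^ 2 * g) := mul_le_mul_of_nonneg_left hx h1.le
    _ = (1 + ε) ^ 2 * ((1 - 2 * ε) * g) := by ring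
    _ ≤ (1 + ε) ^ 2 * ((1 + 2 * ε) * h) := mul_le_mul_of_nonneg_left hgh (sq_nonneg _)
    _ = (1 + ε) ^ 2 * (1 + 2 * ε) * h := by ring
    _ ≤ (1 + 32 * ε) * ((1 - 2 * ε) * (1 - ε) ^ 2) * h := mul_le_mul_of_nonneg_right hp hh
    _ = (1 + 32 * ε) * (1 - 2 * ε) * ((1 - ε) ^ 2 * h) := by ring
    _ ≤ (1 + 32 * ε) * (1 - 2 * ε) * y := mul_le_mul_of_nonneg_left hy (by positivity)
    _ = (1 - 2 * ε) * ((1 + 32 * ε) * y) := by ring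

variable {τ : Tuning N M T} {s : EdgeSplit N K} {A P : Layers N T} {Pstar : Fin M → Layers N T}
  {wHat : Fin M → ℝ}

/-- On the event where the fits are close to their limits and the noise is small, the loss on `Ψ₁`
is close to the loss of the truncated limits, which the cross-validated weights nearly minimize. -/
lemma cv_minimizer {B ε : ℝ} (hB : 2 ≤ B) (hK : 2 ≤ K) (hT : 1 ≤ T)
    (hw : wHat ∈ stdSimplex ℝ (Fin M))
    (hmin : IsMinOn (cv τ s A) (stdSimplex ℝ (Fin M)) wHat)
    (hε : 0 < ε) (hε2 : ε ≤ 1 / 2) (hξ : 0 < xiStar s Pstar P)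
    (hfull : ⨆ m, sqDist s.psi1 (pHat τ s A m) (Pstar m) ≤ ε ^ 2 / 64 * xiStar s Pstar P)
    (hcv : ⨆ m, ∑ k, sqDist (s.G k) (pTilde τ s A k m) (Pstar m) ≤
      ε ^ 2 / 64 * xiStar s Pstar P)
    (hnoise : √(∑ m, innerOn s.psi1 (A - P) (clip B (Pstar m) - P) ^ 2) ≤
      ε ^ 2 / 64 * xiStar s Pstar P)
    (hcross : √(sqDist Finset.univ A P *
      ⨆ m, ∑ k, sqDist (s.G k) (pTilde τ s A k m) (Pstar m)) ≤ ε ^ 2 / 64 * xiStar s Pstar P) :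
    (∀ w ∈ stdSimplex ℝ (Fin M), xiStar s Pstar P ≤
      2 * sqDist s.psi1 (average w fun m => clip B (Pstar m)) P) ∧
    (∀ w ∈ stdSimplex ℝ (Fin M),
      |loss τ s A P s.psi1 w - sqDist s.psi1 (average w fun m => clip B (Pstar m)) P| ≤
        ε * sqDist s.psi1 (average w fun m => clip B (Pstar m)) P) ∧
    (∀ w ∈ stdSimplex ℝ (Fin M),
      (1 - 2 * ε) * sqDist s.psi1 (average wHat fun m => clip B (Pstar m)) P ≤
        (1 + 2 * ε) * sqDist s.psi1 (average w fun m => clip B (Pstar m)) P) := by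
  simp only [sum_sqDist_pTilde] at hcv hcross
  set b := ⨆ m, sqDist s.psi1 (pTildeAll τ s A m) (Pstar m) with hb
  have hle : ∀ m, sqDist s.psi1 (pTildeAll τ s A m) (Pstar m) ≤ b := le_iSup_fin hb.ge
  have h0 := pTildeAll_nonneg hK τ s A
  have h2 : ∀ m t i j, pTildeAll τ s A m t i j ≤ B := fun m t i j =>
    (pTildeAll_le hK τ s A m t i j).trans hB
  have hQ : ∀ m, sqDist s.psi1 (clip B (Pstar m)) (Pstar m) ≤
      sqDist s.psi1 (pTildeAll τ s A m) (Pstar m) := fun m =>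
    sqDist_mono fun t e _ => abs_clip_sub_le (h0 m t e.1 e.2) (h2 m t e.1 e.2)
  have hPt : ∀ m, sqDist s.psi1 (pTildeAll τ s A m) (clip B (Pstar m)) ≤
      sqDist s.psi1 (pTildeAll τ s A m) (Pstar m) := fun m =>
    sqDist_mono fun t e _ => abs_sub_clip_le (h0 m t e.1 e.2) (h2 m t e.1 e.2)
  refine criterion_minimizer (A := A) (Pt := pTildeAll τ s A) (Ph := pHat τ s A) (Pstar := Pstar)
    hw (fun w hw' => ?_) hξ hε hε2 (fun w hw' => xiStar_le s Pstar P hw')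
    (fun m => (hQ m).trans ((hle m).trans hcv)) (fun m => (hPt m).trans ((hle m).trans hcv))
    (fun m => ?_) (abs_le_of_sqrt_sum_le hnoise) (fun w hw' => ?_)
  -- A positive `xiStar` excludes an empty `Ψ₁`, so the normalizing factor of the criterion can be
  -- cancelled.
  · have hcard : s.psi1.card ≠ 0 := by
      intro h
      rw [Finset.card_eq_zero] at h
      have := xiStar_le s Pstar P hw
      simp only [h, sqDist, Finset.sum_empty, Finset.sum_const_zero] at this
      linarith
    have h := hmin hw'
    simp only [Set.mem_ofPred_eq, cv_eq] at h
    have hpos : 0 < 1 / ((T : ℝ) * (s.psi1.card : ℝ)) := by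
      have : 0 < T := hT
      have : 0 < s.psi1.card := Nat.pos_of_ne_zero hcard
      positivity
    exact le_of_mul_le_mul_left h hpos
  -- The full fits on `Ψ₁` may exceed `B`, so the comparison passes through `Pstar`; the budget is
  -- `2 * (ε ^ 2 / 64) + 2 * (ε ^ 2 / 64) = ε ^ 2 / 16`.
  · have a1 := sqDist_triangle (E := s.psi1) (pHat τ s A m) (Pstar m) (clip B (Pstar m))
    rw [sqDist_comm (Pstar m)] at a1
    have a2 := le_iSup_fin hfull m
    have a3 := (hQ m).trans ((hle m).trans hcv)
    linarith
  · refine (Real.abs_le_sqrt (sq_innerOn_le A P _ _)).trans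
      ((Real.sqrt_le_sqrt ?_).trans hcross)
    exact mul_le_mul (sqDist_mono_set (Finset.subset_univ _) A P)
      (sqDist_average_le hw' fun m => (hPt m).trans (hle m)) (sqDist_nonneg _ _ _)
      (sqDist_nonneg _ _ _)

lemma train_loss_ratio {Q : Fin M → Layers N T} {ξ ε : ℝ} (hξ : 0 < ξ) (hε : 0 < ε)
    (hε2 : ε ≤ 1 / 32) (hw : wHat ∈ stdSimplex ℝ (Fin M))
    (hlow : ∀ w ∈ stdSimplex ℝ (Fin M), ξ ≤ 2 * sqDist s.psi1 (average w Q) P)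
    (hloss : ∀ w ∈ stdSimplex ℝ (Fin M),
      |loss τ s A P s.psi1 w - sqDist s.psi1 (average w Q) P| ≤
        ε * sqDist s.psi1 (average w Q) P)
    (hmin : ∀ w ∈ stdSimplex ℝ (Fin M),
      (1 - 2 * ε) * sqDist s.psi1 (average wHat Q) P ≤
        (1 + 2 * ε) * sqDist s.psi1 (average w Q) P) :
    |loss τ s A P s.psi1 wHat / infW (loss τ s A P s.psi1) - 1| ≤ 32 * ε := by
  refine abs_div_infW_sub_one_le hw (κ := ξ / 4) (by positivity) (by positivity)
    (fun w hw' => ?_) fun w hw' => ?_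
  · have := (abs_le.1 (hloss w hw')).1
    have := hlow w hw'
    nlinarith
  · have h0 := sqDist_nonneg s.psi1 (average w Q) P
    have h0' := sqDist_nonneg s.psi1 (average wHat Q) P
    refine le_mul_of_close hε hε2 h0 ?_ (hmin w hw') ?_
    · have := (abs_le.1 (hloss wHat hw)).2
      nlinarith [mul_nonneg hε.le h0', mul_nonneg (sq_nonneg ε) h0']
    · have := (abs_le.1 (hloss w hw')).1
      nlinarith [mul_nonneg hε.le h0, mul_nonneg (mul_nonneg hε.le h0) (by linarith : 0 ≤ 1 - ε)]

/-- If the inner products over `Ψ₁` are close to their expectations under random splitting, then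
the loss on `Ψ₂` is nearly proportional to the loss on `Ψ₁`. -/
lemma test_loss_ratio {B c κ ξ ε : ℝ} (hξ : 0 < ξ) (hε : 0 < ε)
    (hε2 : ε ≤ 1 / 32) (hc : 0 < c) (hcB : 1 / c ≤ B) (hfrac : c ≤ s.fraction)
    (hκ : 0 < κ) (hκ1 : κ ≤ s.rate) (hκ2 : κ ≤ 1 - s.rate)
    (hw : wHat ∈ stdSimplex ℝ (Fin M))
    (hlow : ∀ w ∈ stdSimplex ℝ (Fin M),
      ξ ≤ 2 * sqDist s.psi1 (average w fun m => clip B (Pstar m)) P)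
    (hmin : ∀ w ∈ stdSimplex ℝ (Fin M),
      (1 - 2 * ε) * sqDist s.psi1 (average wHat fun m => clip B (Pstar m)) P ≤
        (1 + 2 * ε) * sqDist s.psi1 (average w fun m => clip B (Pstar m)) P)
    (hdev : √(∑ m, ∑ m', s.deviation (clip B (Pstar m) - P) (clip B (Pstar m') - P) ^ 2) ≤
      ε * κ ^ 2 / 2 * ξ)
    (htest : ⨆ m, sqDist s.psi2 (pHat τ s A m) (Pstar m) ≤ ε ^ 2 * κ / 32 * ξ) :
    |loss τ s A P s.psi2 wHat / infW (loss τ s A P s.psi2) - 1| ≤ 32 * ε := by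
  set Q : Fin M → Layers N T := fun m => clip B (Pstar m)
  set r := s.rate
  set ρ := (1 - r) / r
  have hr : 0 < r := hκ.trans_le hκ1
  have hρ : κ ≤ ρ := by
    rw [le_div_iff₀ hr]; nlinarith
  have hdev' : ∀ m m', |s.deviation (Q m - P) (Q m' - P)| ≤ ε * κ ^ 2 / 2 * ξ := fun m m' => by
    rw [← Fintype.sum_prod_type' (f := fun m m' => s.deviation (Q m - P) (Q m' - P) ^ 2)] at hdev
    exact abs_le_of_sqrt_sum_le (f := fun z : Fin M × Fin M =>
      s.deviation (Q z.1 - P) (Q z.2 - P)) hdev (m, m')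
  have hprop : ∀ w ∈ stdSimplex ℝ (Fin M),
      |sqDist s.psi2 (average w Q) P - ρ * sqDist s.psi1 (average w Q) P| ≤
        ε * (ρ * sqDist s.psi1 (average w Q) P) := by
    intro w hw'
    have e : sqDist s.psi2 (average w Q) P - ρ * sqDist s.psi1 (average w Q) P =
        ∑ m, w m * ∑ m', w m' * (-(1 / r) * s.deviation (Q m - P) (Q m' - P)) := by
      rw [sqDist_average_eq hw', sqDist_average_eq hw', Finset.mul_sum, ← Finset.sum_sub_distrib]
      refine Finset.sum_congr rfl fun m _ => ?_
      rw [mul_left_comm, ← mul_sub, Finset.mul_sum, ← Finset.sum_sub_distrib]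
      refine congrArg _ (Finset.sum_congr rfl fun m' _ => ?_)
      rw [← innerOn_psi2_sub hr.ne']
      ring
    rw [e]
    have h1 : 1 / r ≤ 1 / κ := one_div_le_one_div_of_le hκ hκ1
    have h2 := hlow w hw'
    have h3 := sqDist_nonneg s.psi1 (average w Q) P
    refine abs_sum_weight_le hw' fun m => abs_sum_weight_le hw' fun m' => ?_
    rw [abs_mul, abs_neg, abs_of_pos (by positivity : 0 < 1 / r)]
    -- One factor `κ` of the deviation bound pays for `1 / r`; the other is traded for `ρ ≥ κ`, so
    -- that the error is relative to `ρ` times the training loss.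
    calc 1 / r * |s.deviation (Q m - P) (Q m' - P)|
        ≤ 1 / κ * (ε * κ ^ 2 / 2 * ξ) :=
          mul_le_mul h1 (hdev' m m') (abs_nonneg _) (by positivity)
      _ = ε * κ * (ξ / 2) := by field_simp
      _ ≤ ε * κ * sqDist s.psi1 (average w Q) P := by gcongr; linarith
      _ ≤ ε * ρ * sqDist s.psi1 (average w Q) P := by gcongr
      _ = _ := by ring
  have hlow2 : ∀ w ∈ stdSimplex ℝ (Fin M), κ * ξ ≤ 4 * sqDist s.psi2 (average w Q) P := by
    intro w hw'
    have h1 := (abs_le.1 (hprop w hw')).1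
    have h3 : κ * ξ ≤ 2 * (ρ * sqDist s.psi1 (average w Q) P) := by
      calc κ * ξ ≤ ρ * (2 * sqDist s.psi1 (average w Q) P) :=
            mul_le_mul hρ (hlow w hw') hξ.le (hκ.le.trans hρ)
        _ = _ := by ring
    have h4 : 0 < κ * ξ := by positivity
    nlinarith
  have hclose : ∀ w ∈ stdSimplex ℝ (Fin M),
      |loss τ s A P s.psi2 w - sqDist s.psi2 (average w Q) P| ≤
        ε * sqDist s.psi2 (average w Q) P := fun w hw' => by
    refine abs_sqDist_sub_le_mul hε (by linarith)
      ((sqDist_average_le hw' (c := ε ^ 2 * κ / 32 * ξ) fun m => ?_).trans ?_)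
    · refine le_trans ?_ (le_iSup_fin htest m)
      -- On `Ψ₂` the truncation is justified by the full fits, which lie in `[0, 1 / c]` and hence
      -- in `[0, B]`.
      exact sqDist_mono fun t e _ => abs_sub_clip_le (pHat_nonneg τ s A m t e.1 e.2)
        ((pHat_le hc τ s hfrac A m t e.1 e.2).trans hcB)
    · have := mul_le_mul_of_nonneg_left (hlow2 w hw') (sq_nonneg ε)
      linarith
  refine abs_div_infW_sub_one_le hw (κ := κ * ξ / 8) (by positivity) (by positivity)
    (fun w hw' => ?_) fun w hw' => ?_
  · have a1 := (abs_le.1 (hclose w hw')).1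
    have a2 := hlow2 w hw'
    have a3 := sqDist_nonneg s.psi2 (average w Q) P
    nlinarith
  · have h0 := sqDist_nonneg s.psi1 (average w Q) P
    have hρ0 : 0 < ρ := hκ.trans_le hρ
    refine le_mul_of_close hε hε2 (g := ρ * sqDist s.psi1 (average wHat Q) P)
      (h := ρ * sqDist s.psi1 (average w Q) P) (by positivity) ?_ ?_ ?_
    · have a1 := (abs_le.1 (hclose wHat hw)).2
      have a2 := (abs_le.1 (hprop wHat hw)).2
      have a3 := mul_le_mul_of_nonneg_left a2 (by linarith : 0 ≤ 1 + ε)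
      linarith
    · have := mul_le_mul_of_nonneg_left (hmin w hw') hρ0.le
      linarith
    · have a1 := (abs_le.1 (hclose w hw')).1
      have a2 := (abs_le.1 (hprop w hw')).1
      have a3 := mul_le_mul_of_nonneg_left a2 (by linarith : 0 ≤ 1 - ε)
      linarith

end Realization

/-! ### Stochastic bounds along the sequence of experiments -/

section Sequence

variable {Ω : Type*} [MeasurableSpace Ω] {μ : Measure Ω} [IsProbabilityMeasure μ]
  {N M T K : ℕ → ℕ} {A : ∀ n, Ω → Layers (N n) (T n)} {P : ∀ n, Layers (N n) (T n)}
  {S : ∀ n, Ω → EdgeSplit (N n) (K n)} {ξ : ℕ → Ω → ℝ}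

/-- Each entry has variance at most `D / N`, so the expected noise energy is at most `N D T`;
Markov's inequality concludes. -/
lemma isBigOInProb_sqDist (hA : ∀ n, IsBernoulliNetwork μ (A n) (P n))
    (hP : ∀ n, IsEdgeProb (P n)) (hN : ∀ n, 1 ≤ N n) (hT : ∀ n, 1 ≤ T n) {D : ℕ → ℝ}
    (hD : ∀ n t i j, P n t i j ≤ D n / N n) :
    IsBigOInProb μ (fun n ω => sqDist Finset.univ (A n ω) (P n))
      (fun n _ => (N n : ℝ) * max (D n) (Real.log (N n)) * T n) := by
  have hN' : ∀ n, (1 : ℝ) ≤ N n := fun n => by exact_mod_cast hN n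
  -- The bound at a diagonal entry, where `P` vanishes, forces `D` to be nonnegative.
  have hD0 : ∀ n, 0 ≤ D n := fun n => by
    have h := hD n ⟨0, hT n⟩ ⟨0, hN n⟩ ⟨0, hN n⟩
    rw [(hP n).diag] at h
    have := mul_nonneg h (zero_le_one.trans (hN' n))
    rwa [div_mul_cancel₀ _ (by linarith [hN' n])] at this
  have hcont : ∀ n, Continuous fun R : Layers (N n) (T n) => sqDist Finset.univ R 0 := fun n => by
    unfold sqDist; fun_prop
  have heq : ∀ n ω, sqDist Finset.univ (A n ω) (P n) = sqDist Finset.univ (A n ω - P n) 0 :=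
    fun n ω => by simp [sqDist]
  have hi : ∀ n, Integrable (fun ω => sqDist Finset.univ (A n ω) (P n)) μ := fun n => by
    simp only [heq]
    exact (hA n).integrable_of_continuous (hP n) (hcont n)
  refine isBigOInProb_of_lintegral_le (r := fun n => (N n : ℝ) * D n * T n) one_pos
    (fun n => (hi n).aemeasurable) (fun n ω => sqDist_nonneg _ _ _)
    (fun n => mul_nonneg (mul_nonneg (by positivity) (hD0 n)) (by positivity)) (fun n ω => ?_)
    fun n => ?_
  · refine le_trans ?_ (le_abs_self _)
    gcongr
    exact le_max_left _ _
  · rw [← ofReal_integral_eq_lintegral_ofReal (hi n) (.of_forall fun ω => sqDist_nonneg _ _ _)]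
    refine ENNReal.ofReal_le_ofReal (((hA n).integral_sqDist_le (hP n) (hD n)).trans (le_of_eq ?_))
    have : (N n : ℝ) ≠ 0 := by linarith [hN' n]
    field_simp

/-- Independence lets the split be frozen. Summing squares over the models replaces a maximum and
gives second moment `O(M T² N²)`, within `O((NMT)²)`. -/
lemma isLittleOInProb_noise (hA : ∀ n, IsBernoulliNetwork μ (A n) (P n))
    (hP : ∀ n, IsEdgeProb (P n)) (hS : ∀ n, Measurable (S n))
    (hAS : ∀ n, IndepFun (A n) (S n) μ) (hM : ∀ n, 1 ≤ M n)
    {X : ∀ n, Fin (M n) → Layers (N n) (T n)}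
    {B : ℝ} (hB : 0 < B) (hX : ∀ n m t i j, |X n m t i j| ≤ B)
    (hξ : IsLittleOInProb μ (fun n _ => (N n : ℝ) * M n * T n) ξ) :
    IsLittleOInProb μ (fun n ω => √(∑ m, innerOn (S n ω).psi1 (A n ω - P n) (X n m) ^ 2)) ξ := by
  have hcont : ∀ n (E : Finset (Fin (N n) × Fin (N n))),
      Continuous fun R : Layers (N n) (T n) => ∑ m, innerOn E R (X n m) ^ 2 := fun n E =>
    continuous_finsetSum _ fun m _ => (continuous_innerOn E (X n m)).pow 2
  have hmeas : ∀ n (s : EdgeSplit (N n) (K n)), Measurable fun a : Layers (N n) (T n) =>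
      ∑ m, innerOn s.psi1 (a - P n) (X n m) ^ 2 := fun n s =>
    ((hcont n s.psi1).comp (continuous_sub_right (P n))).measurable
  refine IsBigOInProb.trans_isLittleOInProb (IsBigOInProb.sqrt ?_) hξ
  refine isBigOInProb_of_lintegral_le (C := 4 * B ^ 2)
    (r := fun n => ((N n : ℝ) * M n * T n) ^ 2) (by positivity) (fun n => ?_)
    (fun n ω => Finset.sum_nonneg fun _ _ => sq_nonneg _) (fun n => sq_nonneg _)
    (fun n ω => le_abs_self _) fun n => ?_
  · exact ((measurable_from_prod_countable_left (f := fun z : Layers (N n) (T n) ×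
      EdgeSplit (N n) (K n) => ∑ m, innerOn z.2.psi1 (z.1 - P n) (X n m) ^ 2) (hmeas n)).comp
      ((hA n).measurable.prodMk (hS n))).aemeasurable
  · refine lintegral_le_of_indepFun (hA n).measurable (hS n) (hAS n)
      (F := fun a s => ENNReal.ofReal (∑ m, innerOn s.psi1 (a - P n) (X n m) ^ 2))
      (fun s => (hmeas n s).ennreal_ofReal) fun s => ?_
    rw [← ofReal_integral_eq_lintegral_ofReal
      ((hA n).integrable_of_continuous (hP n) (hcont n s.psi1))
      (.of_forall fun ω => Finset.sum_nonneg fun _ _ => sq_nonneg _)]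
    refine ENNReal.ofReal_le_ofReal
      (((hA n).integral_sum_innerOn_sq_le (hP n) s.psi1 (hX n)).trans ?_)
    have h1 : (1 : ℝ) ≤ M n := by exact_mod_cast hM n
    have h2 : (M n : ℝ) ≤ (M n : ℝ) ^ 2 := by nlinarith
    calc 4 * B ^ 2 * ((M n : ℝ) * T n ^ 2 * N n ^ 2)
        ≤ 4 * B ^ 2 * ((M n : ℝ) ^ 2 * T n ^ 2 * N n ^ 2) := by gcongr
      _ = _ := by ring

/-- The arrays are nonrandom, so only the law of the split matters: `M²` products with second
moments `O((NT)²)` again total `O((NMT)²)`. -/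
lemma isLittleOInProb_deviation (hS : ∀ n, Measurable (S n)) (hU : ∀ n, IsUniformSplit μ (S n))
    (hN : ∀ n, 1 ≤ N n) {X : ∀ n, Fin (M n) → Layers (N n) (T n)} {B : ℝ} (hB : 0 < B)
    (hX : ∀ n m t i j, |X n m t i j| ≤ B)
    (hξ : IsLittleOInProb μ (fun n _ => (N n : ℝ) * M n * T n) ξ) :
    IsLittleOInProb μ
      (fun n ω => √(∑ m, ∑ m', (S n ω).deviation (X n m) (X n m') ^ 2)) ξ := by
  have h0 : ∀ n (s : EdgeSplit (N n) (K n)),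
      0 ≤ ∑ m, ∑ m', s.deviation (X n m) (X n m') ^ 2 := fun n s =>
    Finset.sum_nonneg fun _ _ => Finset.sum_nonneg fun _ _ => sq_nonneg _
  have hmeas : ∀ n, Measurable fun ω => ∑ m, ∑ m', (S n ω).deviation (X n m) (X n m') ^ 2 :=
    fun n => (Measurable.of_discrete
      (f := fun s : EdgeSplit (N n) (K n) => ∑ m, ∑ m', s.deviation (X n m) (X n m') ^ 2)).comp
      (hS n)
  have hi : ∀ n, Integrable (fun ω => ∑ m, ∑ m', (S n ω).deviation (X n m) (X n m') ^ 2) μ := by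
    intro n
    obtain ⟨C, hC⟩ := (Set.finite_range fun s : EdgeSplit (N n) (K n) =>
      ∑ m, ∑ m', s.deviation (X n m) (X n m') ^ 2).bddAbove
    refine .of_bound (hmeas n).aestronglyMeasurable C (.of_forall fun ω => ?_)
    rw [Real.norm_of_nonneg (h0 n _)]
    exact hC ⟨S n ω, rfl⟩
  refine IsBigOInProb.trans_isLittleOInProb (IsBigOInProb.sqrt ?_) hξ
  refine isBigOInProb_of_lintegral_le (C := 8 * B ^ 4)
    (r := fun n => ((N n : ℝ) * M n * T n) ^ 2) (by positivity) (fun n => (hmeas n).aemeasurable)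
    (fun n ω => h0 n _) (fun n => sq_nonneg _) (fun n ω => le_abs_self _) fun n => ?_
  rw [← ofReal_integral_eq_lintegral_ofReal (hi n) (.of_forall fun ω => h0 n _)]
  exact ENNReal.ofReal_le_ofReal ((hU n).integral_deviation_sq_le (hS n) (hN n) (hX n))

end Sequence

end NetMA

theorem theorem4 {Ω : Type*} [MeasurableSpace Ω] (μ : Measure Ω) [IsProbabilityMeasure μ]
    -- numbers of nodes, candidate models, layers and groups along the sequence of experiments
    (N M T K : ℕ → ℕ)
    (hM : ∀ n, 1 ≤ M n) (hT : ∀ n, 1 ≤ T n) (hK : ∀ n, 2 ≤ K n)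
    -- the true parameters, with centred latent vectors, and the network generated by them
    (d : ∀ n, Fin (T n) → ℕ)
    (θ : ∀ n, NetMA.LatentParams (N n) (T n) (d n))
    (hθ : ∀ n t, NetMA.center ((θ n).Z t) = (θ n).Z t)
    (A : ∀ n, Ω → NetMA.Layers (N n) (T n))
    (hA : ∀ n, NetMA.IsBernoulliNetwork μ (A n) (θ n).edgeProb)
    -- the split into training and test pairs and the grouping, independent of the network
    (S : ∀ n, Ω → NetMA.EdgeSplit (N n) (K n))
    (hS : ∀ n, Measurable (S n))
    (hAS : ∀ n, IndepFun (A n) (S n) μ)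
    (hS_card : ∀ R : ℕ, Tendsto (fun n => μ {ω | (S n ω).psi1.card ≤ R}) atTop (𝓝 0))
    -- initial values, step sizes and numbers of iterations of the descent algorithm
    (τ : ∀ n, NetMA.Tuning (N n) (M n) (T n))
    -- the weights minimize the cross-validation criterion
    (wHat : ∀ n, Ω → Fin (M n) → ℝ)
    (hw_mem : ∀ n ω, wHat n ω ∈ stdSimplex ℝ (Fin (M n)))
    (hw_min : ∀ n ω, IsMinOn (NetMA.cv (τ n) (S n ω) (A n ω)) (stdSimplex ℝ (Fin (M n)))
      (wHat n ω))
    -- limiting values, common to the full fits and the leave-one-group-out fits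
    (hMN : ∀ n, M n ≤ N n)
    (Pstar : ∀ n, Fin (M n) → NetMA.Layers (N n) (T n))
    (hlim : NetMA.IsBigOInProb μ
      (fun n ω => ⨆ m, NetMA.sqDist (S n ω).psi1 (NetMA.pHat (τ n) (S n ω) (A n ω) m) (Pstar n m))
      (fun n _ => (N n : ℝ) * M n * T n))
    (hlim_cv : NetMA.IsBigOInProb μ
      (fun n ω => ⨆ m, ∑ k, NetMA.sqDist ((S n ω).G k)
        (NetMA.pTilde (τ n) (S n ω) (A n ω) k m) (Pstar n m))
      (fun n _ => (N n : ℝ) * M n * T n))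
    -- growth of the number of layers
    (C₀ : ℝ) (hC₀ : 0 < C₀)
    (hTN : Tendsto (fun n => (T n : ℝ) * (N n : ℝ) ^ (-C₀)) atTop (𝓝 0))
    -- degree bound and growth of the minimal limiting loss
    (D : ℕ → ℝ)
    (hD : ∀ n t i j, (θ n).edgeProb t i j ≤ D n / N n)
    (hxi_o : NetMA.IsLittleOInProb μ
      (fun n _ => (N n : ℝ) * M n * T n)
      (fun n ω => NetMA.xiStar (S n ω) (Pstar n) (θ n).edgeProb))
    (hxi_O : NetMA.IsBigOInProb μ
      (fun n _ => (N n : ℝ) * max (D n) (Real.log (N n)) * T n)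
      (fun n ω => NetMA.xiStar (S n ω) (Pstar n) (θ n).edgeProb)) :
    -- the loss over `Ψ₁`
    TendstoInMeasure μ
      (fun n ω =>
        NetMA.loss (τ n) (S n ω) (A n ω) (θ n).edgeProb (S n ω).psi1 (wHat n ω) /
          NetMA.infW (NetMA.loss (τ n) (S n ω) (A n ω) (θ n).edgeProb (S n ω).psi1))
      atTop (fun _ => (1 : ℝ)) ∧
    -- the loss over `Ψ₂`, for a split drawn at random with a nondegenerate training fraction, when
    -- the limiting values are limits on `Ψ₂` as well
    ((∀ n, NetMA.IsUniformSplit μ (S n)) →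
      (∃ c : ℝ, 0 < c ∧ Tendsto (fun n =>
        μ {ω | ¬ (c ≤ (S n ω).fraction ∧ (S n ω).fraction ≤ 1 - c)}) atTop (𝓝 0)) →
      NetMA.IsBigOInProb μ
        (fun n ω => ⨆ m,
          NetMA.sqDist (S n ω).psi2 (NetMA.pHat (τ n) (S n ω) (A n ω) m) (Pstar n m))
        (fun n _ => (N n : ℝ) * M n * T n) →
      TendstoInMeasure μ
        (fun n ω =>
          NetMA.loss (τ n) (S n ω) (A n ω) (θ n).edgeProb (S n ω).psi2 (wHat n ω) /
            NetMA.infW (NetMA.loss (τ n) (S n ω) (A n ω) (θ n).edgeProb (S n ω).psi2))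
        atTop (fun _ => (1 : ℝ))) := by
  have hN : ∀ n, 1 ≤ N n := fun n => (hM n).trans (hMN n)
  have hP : ∀ n, NetMA.IsEdgeProb (θ n).edgeProb := fun n => (θ n).isEdgeProb
  set ξ : ℕ → Ω → ℝ := fun n ω => NetMA.xiStar (S n ω) (Pstar n) (θ n).edgeProb with hξdef
  have hξ0 : ∀ n ω, 0 ≤ ξ n ω := fun n ω => NetMA.xiStar_nonneg _ _ _
  -- Taking constant 1 in `NMT = o(ξ)` gives `ξ ≥ NMT ≥ 1` with high probability.
  have hξpos : NetMA.WithHighProb μ fun n ω => 0 < ξ n ω :=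
    (hxi_o.withHighProb one_pos).mono fun n ω h => by
      have h1 : (1 : ℝ) ≤ N n := by exact_mod_cast hN n
      have h2 : (1 : ℝ) ≤ M n := by exact_mod_cast hM n
      have h3 : (1 : ℝ) ≤ T n := by exact_mod_cast hT n
      rw [one_mul, abs_of_nonneg (hξ0 n ω), abs_of_nonneg (by positivity)] at h
      exact lt_of_lt_of_le (by positivity) h
  have hbound : ∀ B : ℝ, 1 ≤ B → ∀ n m t i j,
      |(NetMA.clip B (Pstar n m) - (θ n).edgeProb) t i j| ≤ B := fun B hB n m t i j =>
    NetMA.abs_clip_sub_le_of_mem hB _ _ _ _ _ ((hP n).nonneg t i j) ((hP n).le_one t i j)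
  have hwhp : ∀ {X : ℕ → Ω → ℝ}, NetMA.IsLittleOInProb μ X ξ → ∀ {c : ℝ}, 0 < c →
      NetMA.WithHighProb μ fun n ω => X n ω ≤ c * ξ n ω := fun hX c hc =>
    (hX.withHighProb hc).mono fun n ω h => by
      rw [abs_of_nonneg (hξ0 n ω)] at h
      exact (le_abs_self _).trans h
  have hfull := hlim.trans_isLittleOInProb hxi_o
  have hcv := hlim_cv.trans_isLittleOInProb hxi_o
  have hcross := ((NetMA.isBigOInProb_sqDist hA hP hN hT hD).trans hxi_O).sqrt_mul hcv
  -- The truncation level stays free: 2 suffices for `Ψ₁`, while `Ψ₂` also needs `B ≥ 1 / c` to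
  -- accommodate the full fits.
  have main : ∀ B : ℝ, 2 ≤ B → ∀ ε : ℝ, 0 < ε → ε ≤ 1 / 2 → NetMA.WithHighProb μ fun n ω =>
      0 < ξ n ω ∧
      (∀ w ∈ stdSimplex ℝ (Fin (M n)), ξ n ω ≤ 2 * NetMA.sqDist (S n ω).psi1
        (NetMA.average w fun m => NetMA.clip B (Pstar n m)) (θ n).edgeProb) ∧
      (∀ w ∈ stdSimplex ℝ (Fin (M n)),
        |NetMA.loss (τ n) (S n ω) (A n ω) (θ n).edgeProb (S n ω).psi1 w -
          NetMA.sqDist (S n ω).psi1 (NetMA.average w fun m => NetMA.clip B (Pstar n m))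
            (θ n).edgeProb| ≤
        ε * NetMA.sqDist (S n ω).psi1 (NetMA.average w fun m => NetMA.clip B (Pstar n m))
          (θ n).edgeProb) ∧
      (∀ w ∈ stdSimplex ℝ (Fin (M n)),
        (1 - 2 * ε) * NetMA.sqDist (S n ω).psi1
          (NetMA.average (wHat n ω) fun m => NetMA.clip B (Pstar n m)) (θ n).edgeProb ≤
        (1 + 2 * ε) * NetMA.sqDist (S n ω).psi1
          (NetMA.average w fun m => NetMA.clip B (Pstar n m)) (θ n).edgeProb) := by
    intro B hB ε hε hε2
    have hδ : 0 < ε ^ 2 / 64 := by positivity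
    have hnoise := NetMA.isLittleOInProb_noise hA hP hS hAS hM (by linarith : 0 < B)
      (hbound B (by linarith)) hxi_o
    refine (hξpos.and ((hwhp hfull hδ).and ((hwhp hcv hδ).and
      ((hwhp hnoise hδ).and (hwhp hcross hδ))))).mono fun n ω h => ⟨h.1, ?_⟩
    obtain ⟨h1, h2, h3, h4, h5⟩ := h
    exact NetMA.cv_minimizer hB (hK n) (hT n) (hw_mem n ω) (hw_min n ω) hε hε2 h1 h2 h3 h4 h5
  refine ⟨NetMA.tendstoInMeasure_of_withHighProb fun ε hε hε1 => ?_, fun hU hfrac htest =>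
    NetMA.tendstoInMeasure_of_withHighProb fun ε hε hε1 => ?_⟩
  · refine (main 2 le_rfl (ε / 32) (by positivity) (by linarith)).mono fun n ω h => ?_
    obtain ⟨h1, h2, h3, h4⟩ := h
    have := NetMA.train_loss_ratio h1 (by positivity) (by linarith) (hw_mem n ω) h2 h3 h4
    linarith
  · obtain ⟨c, hc, hfrac⟩ := hfrac
    have hB : 2 ≤ max 2 (1 / c) := le_max_left _ _
    have hdev := NetMA.isLittleOInProb_deviation hS hU hN
      (by linarith : 0 < max 2 (1 / c)) (hbound (max 2 (1 / c)) (by linarith)) hxi_o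
    have hfrac' : NetMA.WithHighProb μ fun n ω =>
        c ≤ (S n ω).fraction ∧ (S n ω).fraction ≤ 1 - c := hfrac
    refine ((main _ hB (ε / 32) (by positivity) (by linarith)).and (hfrac'.and
      ((hwhp hdev (c := ε / 32 * (c / 2) ^ 2 / 2) (by positivity)).and
      (hwhp (htest.trans_isLittleOInProb hxi_o) (c := (ε / 32) ^ 2 * (c / 2) / 32)
        (by positivity))))).mono fun n ω h => ?_
    obtain ⟨⟨h1, h2, -, h4⟩, ⟨h5, h6⟩, h7, h8⟩ := h
    obtain ⟨h9, h10⟩ := (S n ω).rate_bounds (hN n) h5 h6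
    have := NetMA.test_loss_ratio h1 (by positivity) (by linarith) hc (le_max_right _ _) h5
      (half_pos hc) h9 h10 (hw_mem n ω) h2 h4 h7 h8
    linarith
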